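/- Let $d\ge 0$, $M\ge 1$. In the normal mixture-of-regressions model with varying concentrations one has independent subjects $O_1,O_2,\dots$; subject $O_j$ belongs to an unobserved component $\kappa_j\in\{1,\dots,M\}$ with known probabilities $p_j^m=\mathrm P\{\kappa_j=m\}$, $\mathbf p_j=(p_j^1,\dots,p_j^M)$. Given $\kappa_j=m$, the regressor vector $X_j$ and the error $\varepsilon_j$ are independent, $X_j\sim N(\mu_m,\Sigma_m)$ in $\mathbb R^d$ and $\varepsilon_j\sim N(0,\sigma_m^2)$. One observes $\xi_j=(Y_j,X_j)$, where $Y_j=X_j^T b^{\kappa_j}+\varepsilon_j$. Let $\tau_{(m)}=(b^m,\mu_m,\Sigma_m,\sigma_m^2)$ and let $\tau=(\tau_{(1)},\dots,\tau_{(M)})\in\mathbb R^P$ be the vector of all unknown parameters, where a symmetric matrix $\Sigma_m$ is given by its $d(d+1)/2$ entries indexed by unordered pairs of indices. For $\xi=(y,x)$ and $\mathbf p=(p^1,\dots,p^M)$ put $$f_{\mathbf p}(\xi;\tau)=\sum_{m=1}^M p^m\,\varphi_{\mu_m,\Sigma_m}(x)\,\varphi_{0,\sigma_m^2}(y-x^Tb^m),\qquad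 L(\xi,\mathbf p,\tau)=\ln f_{\mathbf p}(\xi;\tau),$$ where $\varphi_{\mu,\Sigma}$ is the density of $N(\mu,\Sigma)$, and $$I_{il}(\mathbf p,\tau)=\mathrm E\,\frac{\partial L(\xi_{\mathbf p},\mathbf p,\tau)}{\partial\tau_i}\frac{\partial L(\xi_{\mathbf p},\mathbf p,\tau)}{\partial\tau_l},\qquad \mathbf I^*(n,\tau)=\sum_{j=1}^n \big(I_{il}(\mathbf p_j,\tau)\big)_{i,l=1}^P,$$ where $\xi_{\mathbf p}$ has density $f_{\mathbf p}(\cdot;\tau)$, and $$\hat I_{il}(n,\tau')=\sum_{j=1}^n\frac{\partial L(\xi_j,\mathbf p_j,\tau')}{\partial\tau_i}\frac{\partial L(\xi_j,\mathbf p_j,\tau')}{\partial\tau_l}.$$ For a square matrix $\mathbf I$ let $\|\mathbf I\|=\sup_{\|u\|=1}|u^T\mathbf I u|$. Let $\tau$ be the true parameter and assume that 1. $\sigma_m^2>0$ and the covariance matrix $\Sigma_m$ is nonsingular for all $m=1,\dots,M$; 2. there exists $c>0$ such that $p_j^m>c$ for all $j\ge 1$ and $m=1,\dots,M$; 3. $\tau_{(l)}\ne\tau_{(m)}$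 for all $l\ne m$. Then the expectations that define $\mathbf I^*(n,\tau)$ are finite, and 1. there exist $0<c_0<C_1<\infty$ such that $c_0n\le\|\mathbf I^*(n,\tau)\|\le C_1n$ for all $n=1,2,\dots$; 2. for every sequence of estimators $\hat\tau_n$ with $\hat\tau_n\to\tau$ in probability, $\frac1n\|\mathbf I^*(n,\tau)-\hat{\mathbf I}(n,\hat\tau_n)\|\to0$ in probability as $n\to\infty$. -/

import Mathlib

open MeasureTheory ProbabilityTheory Filter Topology

noncomputable section

namespace MixReg

/-- Scalar coordinates of the parameters of one component, in this order: the regression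
coefficients, the regressor mean, the entries of the symmetric regressor covariance matrix
(one for every unordered pair of indices) and the error variance. -/
abbrev Coord (d : ℕ) : Type := Fin d ⊕ Fin d ⊕ Sym2 (Fin d) ⊕ Unit

/-- The vector `τ` of all parameters of a mixture with `M` components and `d` regressors. -/
abbrev Param (d M : ℕ) : Type := Fin M × Coord d → ℝ

/-- One observation `(Y, X)`. -/
abbrev Obs (d : ℕ) : Type := ℝ × EuclideanSpace ℝ (Fin d)

variable {d M : ℕ}

/-- All parameters of the `m`-th component. -/
def component (τ : Param d M) (m : Fin M) : Coord d → ℝ := fun c => τ (m, c)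

/-- The vector of regression coefficients of the `m`-th component. -/
def coef (τ : Param d M) (m : Fin M) : Fin d → ℝ := fun i => τ (m, .inl i)

/-- The mean of the regressors in the `m`-th component. -/
def regMean (τ : Param d M) (m : Fin M) : EuclideanSpace ℝ (Fin d) :=
  WithLp.toLp 2 fun i => τ (m, .inr (.inl i))

/-- The covariance matrix of the regressors in the `m`-th component. -/
def regCov (τ : Param d M) (m : Fin M) : Matrix (Fin d) (Fin d) ℝ :=
  Matrix.of fun i k => τ (m, .inr (.inr (.inl s(i, k))))

/-- The error variance in the `m`-th component. -/
def errVar (τ : Param d M) (m : Fin M) : ℝ := τ (m, .inr (.inr (.inr ())))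

/-- The linear predictor `xᵀ b`. -/
def linPred (x : EuclideanSpace ℝ (Fin d)) (b : Fin d → ℝ) : ℝ := ∑ i, b i * x i

/-- The density of the nondegenerate normal distribution `N(μ, S)` on `ℝ^d`. -/
def normalDensity (μ : EuclideanSpace ℝ (Fin d)) (S : Matrix (Fin d) (Fin d) ℝ)
    (x : EuclideanSpace ℝ (Fin d)) : ℝ :=
  (√((2 * Real.pi) ^ d * S.det))⁻¹ *
    Real.exp (-(∑ i, ∑ k, (x i - μ i) * S⁻¹ i k * (x k - μ k)) / 2)

/-- The density of an observation `z = (y, x)` that belongs to the `m`-th component with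
probability `q m`. -/
def mixDensity (q : Fin M → ℝ) (τ : Param d M) (z : Obs d) : ℝ :=
  ∑ m, q m * normalDensity (regMean τ m) (regCov τ m) z.2 *
    gaussianPDFReal 0 (errVar τ m).toNNReal (z.1 - linPred z.2 (coef τ m))

/-- The log-likelihood of one observation. -/
def logLik (z : Obs d) (q : Fin M → ℝ) (τ : Param d M) : ℝ := Real.log (mixDensity q τ z)

/-- The partial derivative of the log-likelihood of one observation with respect to the
`i`-th coordinate of the parameter vector. -/
def score (z : Obs d) (q : Fin M → ℝ) (τ : Param d M) (i : Fin M × Coord d) : ℝ :=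
  deriv (fun t => logLik z q (Function.update τ i t)) (τ i)

/-- The distribution on the observation space with density `mixDensity q τ`. -/
def mixLaw (q : Fin M → ℝ) (τ : Param d M) : Measure (Obs d) :=
  volume.withDensity fun z => ENNReal.ofReal (mixDensity q τ z)

/-- The Fisher information matrix of one observation. -/
def fisherOne (q : Fin M → ℝ) (τ : Param d M) :
    Matrix (Fin M × Coord d) (Fin M × Coord d) ℝ :=
  Matrix.of fun i l => ∫ z, score z q τ i * score z q τ l ∂(mixLaw q τ)

/-- The Fisher information matrix of the first `n` observations; `p j m` is the probability
that subject `j` belongs to component `m` (subjects are numbered from `0`). -/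
def fisher (p : ℕ → Fin M → ℝ) (n : ℕ) (τ : Param d M) :
    Matrix (Fin M × Coord d) (Fin M × Coord d) ℝ :=
  ∑ j ∈ Finset.range n, fisherOne (p j) τ

/-- The empirical information matrix of the first `n` members of the sequence of observations
`ξ`, at the parameter value `τ`. -/
def empInfo (p : ℕ → Fin M → ℝ) (ξ : ℕ → Obs d) (n : ℕ) (τ : Param d M) :
    Matrix (Fin M × Coord d) (Fin M × Coord d) ℝ :=
  Matrix.of fun i l => ∑ j ∈ Finset.range n, score (ξ j) (p j) τ i * score (ξ j) (p j) τ l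

/-- `sup |uᵀ A u|` over the vectors `u` of Euclidean norm `1`. -/
def quadNorm {ι : Type*} [Fintype ι] (A : Matrix ι ι ℝ) : ℝ :=
  sSup {r : ℝ | ∃ u : EuclideanSpace ℝ ι, ‖u‖ = 1 ∧ r = |∑ i, ∑ l, u i * A i l * u l|}

/-- The normal mixture-of-regressions model with varying concentrations. Subject `j` has the
(unobserved) component number `κ j`, the regressors `X j` and the (unobserved) error `ε j`. -/
structure IsNormalModel {Ω : Type*} [MeasurableSpace Ω] (P : Measure Ω)
    (p : ℕ → Fin M → ℝ) (τ : Param d M) (κ : ℕ → Ω → Fin M)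
    (X : ℕ → Ω → EuclideanSpace ℝ (Fin d)) (ε : ℕ → Ω → ℝ) : Prop where
  measurable_component : ∀ j, Measurable (κ j)
  measurable_regressors : ∀ j, Measurable (X j)
  measurable_error : ∀ j, Measurable (ε j)
  /-- different subjects are independent -/
  indep_subjects : iIndepFun (fun j ω => (κ j ω, X j ω, ε j ω)) P
  /-- the mixing probabilities -/
  mixing_prob : ∀ j m, P.real (κ j ⁻¹' {m}) = p j m
  /-- conditionally on the component, regressors and error are independent -/
  cond_indep : ∀ j m, P (κ j ⁻¹' {m}) ≠ 0 → IndepFun (X j) (ε j) (cond P (κ j ⁻¹' {m}))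
  /-- conditional distribution of the regressors -/
  regressor_law : ∀ j m, P (κ j ⁻¹' {m}) ≠ 0 →
    (cond P (κ j ⁻¹' {m})).map (X j) = multivariateGaussian (regMean τ m) (regCov τ m)
  /-- conditional distribution of the error -/
  error_law : ∀ j m, P (κ j ⁻¹' {m}) ≠ 0 →
    (cond P (κ j ⁻¹' {m})).map (ε j) = gaussianReal 0 (errVar τ m).toNNReal

/-- The observation `(Y, X)` of a subject, where the response `Y` follows the linear regression
of the component that the subject belongs to. -/
def observe (τ : Param d M) (k : Fin M) (x : EuclideanSpace ℝ (Fin d)) (e : ℝ) : Obs d :=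
  (linPred x (coef τ k) + e, x)

end MixReg

end

open MixReg

noncomputable section

namespace MixReg

/-! The score of one observation is the posterior mean of the component scores
(`score_eq_sum_posterior`). Each component log-density is quadratic in the observation with
coefficients smooth in the parameter, so its partial derivatives grow polynomially, while the
posterior weights lie in $[0,1]$. As functions of the component log-densities these weights are
Lipschitz with a constant free of the mixing probabilities (`softmax_sub_le`). Hence a product of
two scores is dominated by a power of `1 + ‖z‖` and is continuous in the parameter at `τ` relative
to such a power, both uniformly over all subjects (`weightedContinuousAt_score_mul`). Gaussian laws
have all moments, which gives integrability and the upper bound on the information.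

For the lower bound, the norm dominates every diagonal entry, so one entry of linear growth
suffices. The entry of an error variance is convenient: its score is one posterior weight times an
explicit function of the residual. Replacing the mixing probabilities by unit weights costs only
powers of `c`, which leaves a positive constant common to all subjects (`exists_le_fisherOne`).

For consistency, every entry of the difference is split at the true parameter. The fluctuation of
the empirical information at `τ` is handled by Chebyshev's inequality
(`IsNormalModel.tendstoInMeasure_fisher_sub`). When the estimator is near `τ`, moving to it changes
the normalised entry by at most a small multiple of the empirical mean of a power of the weight,
which Markov's inequality bounds in probability (`IsNormalModel.tendstoInMeasure_empInfo_sub`). -/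

/-! ### Densities of standard and multivariate normal laws. -/

theorem pi_gaussianReal_eq_withDensity {ι : Type*} [Fintype ι] :
    Measure.pi (fun _ : ι => gaussianReal 0 1) =
      volume.withDensity fun v => ENNReal.ofReal (∏ i, gaussianPDFReal 0 1 (v i)) := by
  classical
  refine Measure.pi_eq fun s hs => ?_
  rw [withDensity_apply _ (MeasurableSet.univ_pi hs), ← lintegral_indicator
    (MeasurableSet.univ_pi hs)]
  have h1 : ∀ v : ι → ℝ, (Set.univ.pi s).indicator
      (fun v => ENNReal.ofReal (∏ i, gaussianPDFReal 0 1 (v i))) v =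
      ENNReal.ofReal (∏ i, (s i).indicator (gaussianPDFReal 0 1) (v i)) := by
    intro v
    by_cases hv : v ∈ Set.univ.pi s
    · rw [Set.indicator_of_mem hv]
      congr 1
      refine Finset.prod_congr rfl fun i _ => ?_
      rw [Set.indicator_of_mem (hv i (Set.mem_univ i))]
    · rw [Set.indicator_of_notMem hv]
      simp only [Set.mem_pi, Set.mem_univ, true_implies, not_forall] at hv
      obtain ⟨i, hi⟩ := hv
      rw [Finset.prod_eq_zero (Finset.mem_univ i) (Set.indicator_of_notMem hi _),
        ENNReal.ofReal_zero]
  simp_rw [h1]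
  have hint : ∀ i, Integrable ((s i).indicator (gaussianPDFReal 0 1)) := fun i =>
    (integrable_gaussianPDFReal 0 1).indicator (hs i)
  have hnn : ∀ i x, 0 ≤ (s i).indicator (gaussianPDFReal 0 1) x := fun i x =>
    Set.indicator_nonneg (fun y _ => gaussianPDFReal_nonneg 0 1 y) x
  rw [← ofReal_integral_eq_lintegral_ofReal]
  · rw [integral_fintype_prod_volume_eq_prod (fun i x => (s i).indicator (gaussianPDFReal 0 1) x),
      ENNReal.ofReal_prod_of_nonneg fun i _ => integral_nonneg (hnn i)]
    refine Finset.prod_congr rfl fun i _ => ?_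
    rw [gaussianReal_apply_eq_integral 0 one_ne_zero, integral_indicator (hs i)]
  · exact Integrable.fintype_prod (f := fun i x => (s i).indicator (gaussianPDFReal 0 1) x) hint
  · exact ae_of_all _ fun v => Finset.prod_nonneg fun i _ => hnn i (v i)

theorem measurable_normalDensity {d : ℕ} (μ : EuclideanSpace ℝ (Fin d))
    (S : Matrix (Fin d) (Fin d) ℝ) : Measurable (normalDensity μ S) := by
  unfold normalDensity
  fun_prop

theorem normalDensity_pos {d : ℕ} (μ : EuclideanSpace ℝ (Fin d))
    {S : Matrix (Fin d) (Fin d) ℝ} (hS : 0 < S.det) (x : EuclideanSpace ℝ (Fin d)) :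
    0 < normalDensity μ S x := by
  unfold normalDensity
  have := Real.pi_pos
  positivity

-- `multivariateGaussian` is the image of the standard Gaussian under `CFC.sqrt S`; the change of
-- variables needs this particular root to be symmetric.
open scoped MatrixOrder in
theorem exists_sqrt_matrix {d : ℕ} {S : Matrix (Fin d) (Fin d) ℝ} (hS : S.PosSemidef) :
    ∃ A : Matrix (Fin d) (Fin d) ℝ, A = CFC.sqrt S ∧ A * A = S ∧ A.transpose = A := by
  refine ⟨_, rfl, CFC.sqrt_mul_sqrt_self _ hS.nonneg, ?_⟩
  have := (CFC.sqrt_nonneg S).isSelfAdjoint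
  rw [isSelfAdjoint_iff, Matrix.star_eq_conjTranspose, Matrix.conjTranspose_eq_transpose_of_trivial]
    at this
  exact this

/-- The standard normal density at `v` is the density of `N(μ, A²)` at `μ + A v`, up to the
Jacobian. -/
theorem prod_gaussianPDFReal_eq {d : ℕ} (μ : EuclideanSpace ℝ (Fin d))
    {A : Matrix (Fin d) (Fin d) ℝ} (hA : A.transpose = A) (hdet : A.det ≠ 0) (v : Fin d → ℝ) :
    ∏ i, gaussianPDFReal 0 1 (v i) =
      |A.det| * normalDensity μ (A * A) (μ + WithLp.toLp 2 (A.mulVec v)) := by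
  have hu : IsUnit A.det := isUnit_iff_ne_zero.2 hdet
  -- Since `A` is symmetric, $(Av)^T(AA)^{-1}Av = (Av)^TA^{-1}v = v^Tv$.
  have hquad : (∑ i, ∑ k, (A.mulVec v) i * (A * A)⁻¹ i k * (A.mulVec v) k) = ∑ i, v i ^ 2 := by
    have h1 : (∑ i, ∑ k, (A.mulVec v) i * (A * A)⁻¹ i k * (A.mulVec v) k) =
        (A.mulVec v) ⬝ᵥ ((A * A)⁻¹.mulVec (A.mulVec v)) := by
      simp only [dotProduct, Matrix.mulVec, Finset.mul_sum, mul_assoc]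
    have h2 : (A * A)⁻¹.mulVec (A.mulVec v) = A⁻¹.mulVec v := by
      rw [Matrix.mulVec_mulVec, Matrix.mul_inv_rev, Matrix.mul_assoc, Matrix.nonsing_inv_mul _ hu,
        Matrix.mul_one]
    have h3 : (A.mulVec v) ⬝ᵥ (A⁻¹.mulVec v) = v ⬝ᵥ v := by
      rw [Matrix.dotProduct_mulVec, ← Matrix.mulVec_transpose, Matrix.mulVec_mulVec,
        Matrix.transpose_nonsing_inv, hA, Matrix.nonsing_inv_mul _ hu, Matrix.one_mulVec]
    rw [h1, h2, h3]
    simp [dotProduct, sq]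
  have hpi := Real.pi_pos
  unfold normalDensity gaussianPDFReal
  simp only [PiLp.add_apply, add_sub_cancel_left]
  rw [hquad, Finset.prod_mul_distrib, ← Real.exp_sum, Finset.prod_const, Finset.card_univ,
    Fintype.card_fin, ← mul_assoc]
  congr 1
  · rw [Matrix.det_mul, Real.sqrt_mul (by positivity) (A.det * A.det),
      Real.sqrt_mul_self_eq_abs]
    have h0 : |A.det| ≠ 0 := abs_ne_zero.2 hdet
    have h1 : √((2 * Real.pi) ^ d) = √(2 * Real.pi) ^ d := by
      rw [Real.sqrt_eq_iff_mul_self_eq (by positivity) (by positivity), ← mul_pow,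
        Real.mul_self_sqrt (by positivity)]
    rw [h1, mul_inv, mul_comm |A.det|, inv_mul_cancel_right₀ h0]
    simp [← inv_pow, mul_comm]
  · congr 1
    rw [← Finset.sum_neg_distrib, Finset.sum_div]
    simp

theorem multivariateGaussian_eq_withDensity {d : ℕ} (μ : EuclideanSpace ℝ (Fin d))
    {S : Matrix (Fin d) (Fin d) ℝ} (hS : S.PosSemidef) (hdet : S.det ≠ 0) :
    multivariateGaussian μ S =
      volume.withDensity fun x => ENNReal.ofReal (normalDensity μ S x) := by
  obtain ⟨A, hAS, hAA, hAt⟩ := exists_sqrt_matrix hS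
  have hAdet : A.det ≠ 0 := by
    intro h
    rw [← hAA, Matrix.det_mul, h, mul_zero] at hdet
    exact hdet rfl
  have hmD := measurable_normalDensity μ S
  refine Measure.ext_of_lintegral _ fun F hF => ?_
  rw [lintegral_withDensity_eq_lintegral_mul _ hmD.ennreal_ofReal hF]
  unfold multivariateGaussian
  rw [← hAS, ← map_pi_eq_stdGaussian, Measure.map_map (by fun_prop) (by fun_prop),
    lintegral_map hF (by fun_prop), pi_gaussianReal_eq_withDensity,
    lintegral_withDensity_eq_lintegral_mul _ (by fun_prop)
      (g := fun v => F (((fun x => μ + Matrix.toEuclideanCLM (𝕜 := ℝ) A x) ∘ WithLp.toLp 2) v))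
      (hF.comp (by fun_prop))]
  set G : EuclideanSpace ℝ (Fin d) → ENNReal := (fun x => ENNReal.ofReal (normalDensity μ S x)) * F
    with hG
  have hGm : Measurable G := hmD.ennreal_ofReal.mul hF
  have hGm' : Measurable fun w : Fin d → ℝ => G (μ + WithLp.toLp 2 w) := by fun_prop
  have h1 : ∀ v : Fin d → ℝ, ((fun v : Fin d → ℝ => ENNReal.ofReal (∏ i, gaussianPDFReal 0 1 (v i)))
      * fun v => F (((fun x => μ + Matrix.toEuclideanCLM (𝕜 := ℝ) A x) ∘ WithLp.toLp 2) v)) v =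
      ENNReal.ofReal |A.det| * G (μ + WithLp.toLp 2 (Matrix.toLin' A v)) := by
    intro v
    simp only [Pi.mul_apply, Function.comp_apply, hG, Matrix.toEuclideanCLM_toLp,
      Matrix.toLin'_apply]
    rw [prod_gaussianPDFReal_eq μ hAt hAdet, hAA, ENNReal.ofReal_mul (abs_nonneg _), mul_assoc]
  rw [lintegral_congr h1, lintegral_const_mul _ (by
    refine hGm'.comp (Continuous.measurable ?_)
    exact LinearMap.continuous_of_finiteDimensional _)]
  -- The substitution $w=Av$ contributes $|\det A|^{-1}$, which cancels the Jacobian factor; the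
  -- remaining shift by `μ` preserves Lebesgue measure.
  rw [← lintegral_map (f := fun w : Fin d → ℝ => G (μ + WithLp.toLp 2 w)) hGm'
    (LinearMap.continuous_of_finiteDimensional _).measurable,
    Real.map_matrix_volume_pi_eq_smul_volume_pi hAdet, lintegral_smul_measure, smul_eq_mul,
    ← mul_assoc, ← ENNReal.ofReal_mul (abs_nonneg _), ← abs_mul, mul_inv_cancel₀ hAdet]
  simp only [abs_one, ENNReal.ofReal_one, one_mul]
  rw [(PiLp.volume_preserving_toLp (Fin d)).lintegral_comp (f := fun x => G (μ + x)) (by fun_prop),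
    lintegral_add_left_eq_self]

/-! ### Component laws and the mixture law. -/

/-- The density of an observation from the `m`-th component. -/
def compDensity {d M : ℕ} (τ : Param d M) (m : Fin M) (z : Obs d) : ℝ :=
  normalDensity (regMean τ m) (regCov τ m) z.2 *
    gaussianPDFReal 0 (errVar τ m).toNNReal (z.1 - linPred z.2 (coef τ m))

/-- The distribution of an observation from the `m`-th component. -/
def compLaw {d M : ℕ} (τ : Param d M) (m : Fin M) : Measure (Obs d) :=
  ((multivariateGaussian (regMean τ m) (regCov τ m)).prod
    (gaussianReal 0 (errVar τ m).toNNReal)).map fun v => observe τ m v.1 v.2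

variable {d M : ℕ}

theorem mixDensity_eq_sum (q : Fin M → ℝ) (τ : Param d M) (z : Obs d) :
    mixDensity q τ z = ∑ m, q m * compDensity τ m z := by
  simp only [mixDensity, compDensity, mul_assoc]

theorem measurable_linPred (b : Fin d → ℝ) :
    Measurable fun x : EuclideanSpace ℝ (Fin d) => linPred x b := by
  unfold linPred
  fun_prop

theorem measurable_compDensity (τ : Param d M) (m : Fin M) : Measurable (compDensity τ m) := by
  unfold compDensity
  exact ((measurable_normalDensity _ _).comp measurable_snd).mul
    ((measurable_gaussianPDFReal _ _).comp
      (measurable_fst.sub ((measurable_linPred _).comp measurable_snd)))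

theorem measurable_observe (τ : Param d M) (m : Fin M) :
    Measurable fun v : EuclideanSpace ℝ (Fin d) × ℝ => observe τ m v.1 v.2 := by
  unfold observe
  exact (((measurable_linPred _).comp measurable_fst).add measurable_snd).prodMk measurable_fst

theorem compDensity_pos {τ : Param d M} {m : Fin M} (hv : 0 < errVar τ m)
    (hd : 0 < (regCov τ m).det) (z : Obs d) : 0 < compDensity τ m z :=
  mul_pos (normalDensity_pos _ hd _) (gaussianPDFReal_pos _ _ _ (by simpa using hv))

theorem compLaw_eq_withDensity {τ : Param d M} {m : Fin M} (hS : (regCov τ m).PosSemidef)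
    (hdet : (regCov τ m).det ≠ 0) (hv : 0 < errVar τ m) :
    compLaw τ m = volume.withDensity fun z => ENNReal.ofReal (compDensity τ m z) := by
  have hv' : (errVar τ m).toNNReal ≠ 0 := by simpa using hv
  have hd : 0 < (regCov τ m).det := lt_of_le_of_ne hS.det_nonneg (Ne.symm hdet)
  have hmN := (measurable_normalDensity (regMean τ m) (regCov τ m)).ennreal_ofReal
  have hmG := measurable_gaussianPDF 0 (errVar τ m).toNNReal
  have hmD : Measurable fun v : EuclideanSpace ℝ (Fin d) × ℝ =>
      ENNReal.ofReal (normalDensity (regMean τ m) (regCov τ m) v.1) *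
        gaussianPDF 0 (errVar τ m).toNNReal v.2 :=
    (hmN.comp measurable_fst).mul (hmG.comp measurable_snd)
  refine Measure.ext_of_lintegral _ fun F hF => ?_
  unfold compLaw
  rw [lintegral_map hF (measurable_observe τ m), multivariateGaussian_eq_withDensity _ hS hdet,
    gaussianReal_of_var_ne_zero 0 hv', prod_withDensity hmN hmG,
    lintegral_withDensity_eq_lintegral_mul _
      hmD
      (g := fun v : EuclideanSpace ℝ (Fin d) × ℝ => F (observe τ m v.1 v.2)) (hF.comp (measurable_observe τ m)),
    lintegral_withDensity_eq_lintegral_mul _ (measurable_compDensity τ m).ennreal_ofReal hF]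
  rw [Measure.volume_eq_prod, lintegral_prod _ (by
      exact (hmD.mul (hF.comp (measurable_observe τ m))).aemeasurable), lintegral_prod_symm _
    ((measurable_compDensity τ m).ennreal_ofReal.mul hF).aemeasurable]
  refine lintegral_congr fun x => ?_
  symm
  -- For fixed `x`, Lebesgue measure in `y` is invariant under the shift by the linear predictor,
  -- and this shift turns the residual into the error.
  rw [← lintegral_add_left_eq_self _ (linPred x (coef τ m))]
  refine lintegral_congr fun e => ?_
  simp only [Pi.mul_apply, compDensity, observe, add_sub_cancel_left, gaussianPDF]
  rw [ENNReal.ofReal_mul (normalDensity_pos _ hd _).le]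

/-- The observation is a linear image of the Gaussian pair of regressors and error. Finiteness of
all moments of a component law comes from here. -/
instance isGaussian_compLaw (τ : Param d M) (m : Fin M) : IsGaussian (compLaw τ m) := by
  let L : EuclideanSpace ℝ (Fin d) × ℝ →L[ℝ] Obs d :=
    ((∑ i, coef τ m i • ((EuclideanSpace.proj i : EuclideanSpace ℝ (Fin d) →L[ℝ] ℝ).comp
      (ContinuousLinearMap.fst ℝ _ _))) + ContinuousLinearMap.snd ℝ _ _).prod
      (ContinuousLinearMap.fst ℝ _ _)
  have hL : (fun v : EuclideanSpace ℝ (Fin d) × ℝ => observe τ m v.1 v.2) = L := by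
    ext v <;> simp [L, observe, linPred]
  unfold compLaw
  rw [hL]
  infer_instance

theorem mixLaw_eq_sum {τ : Param d M} (hS : ∀ m, (regCov τ m).PosSemidef)
    (hdet : ∀ m, (regCov τ m).det ≠ 0) (hv : ∀ m, 0 < errVar τ m) {q : Fin M → ℝ}
    (hq : ∀ m, 0 ≤ q m) :
    mixLaw q τ = ∑ m, ENNReal.ofReal (q m) • compLaw τ m := by
  have hd : ∀ m, 0 < (regCov τ m).det := fun m =>
    lt_of_le_of_ne (hS m).det_nonneg (Ne.symm (hdet m))
  refine Measure.ext_of_lintegral _ fun F hF => ?_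
  unfold mixLaw
  have hm : Measurable fun z => ENNReal.ofReal (mixDensity q τ z) := by
    simp_rw [mixDensity_eq_sum]
    exact (Finset.measurable_sum _ fun m _ =>
      (measurable_compDensity τ m).const_mul _).ennreal_ofReal
  rw [lintegral_withDensity_eq_lintegral_mul _ hm hF, lintegral_finsetSum_measure]
  have h1 : ∀ z, ((fun z => ENNReal.ofReal (mixDensity q τ z)) * F) z =
      ∑ m, ENNReal.ofReal (q m) * (ENNReal.ofReal (compDensity τ m z) * F z) := by
    intro z
    simp only [Pi.mul_apply]
    rw [mixDensity_eq_sum, ENNReal.ofReal_sum_of_nonneg fun m _ =>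
      mul_nonneg (hq m) (compDensity_pos (hv m) (hd m) z).le, Finset.sum_mul]
    refine Finset.sum_congr rfl fun m _ => ?_
    rw [ENNReal.ofReal_mul (hq m), mul_assoc]
  have hmm : ∀ m, Measurable fun z => ENNReal.ofReal (compDensity τ m z) * F z := fun m =>
    (measurable_compDensity τ m).ennreal_ofReal.mul hF
  rw [lintegral_congr h1, lintegral_finsetSum _ fun m _ => (hmm m).const_mul _]
  refine Finset.sum_congr rfl fun m _ => ?_
  rw [lintegral_const_mul _ (hmm m), lintegral_smul_measure, smul_eq_mul,
    compLaw_eq_withDensity (hS m) (hdet m) (hv m),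
    lintegral_withDensity_eq_lintegral_mul _ (measurable_compDensity τ m).ennreal_ofReal hF]
  rfl

/-! ### Continuity in the parameter, uniform relative to a polynomial weight. -/

/-- `F a t` is continuous at `t = τ`, uniformly in `a` with respect to a power of the weight `w`. -/
def WeightedContinuousAt {α T : Type*} [TopologicalSpace T] (w : α → ℝ) (F : α → T → ℝ) (τ : T) :
    Prop :=
  ∃ N : ℕ, (∃ K, ∀ a, |F a τ| ≤ K * w a ^ N) ∧
    ∀ e > 0, ∀ᶠ t in 𝓝 τ, ∀ a, |F a t - F a τ| ≤ e * w a ^ N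

namespace WeightedContinuousAt

variable {α T : Type*} [TopologicalSpace T] {w : α → ℝ} {F G : α → T → ℝ} {τ : T}

theorem congr (hF : WeightedContinuousAt w F τ) (h : ∀ᶠ t in 𝓝 τ, ∀ a, F a t = G a t) :
    WeightedContinuousAt w G τ := by
  obtain ⟨N, ⟨K, hK⟩, hN⟩ := hF
  have h0 := h.self_of_nhds
  refine ⟨N, ⟨K, fun a => h0 a ▸ hK a⟩, fun e he => ?_⟩
  filter_upwards [hN e he, h] with t ht h1 a
  rw [← h1 a, ← h0 a]
  exact ht a

theorem mono_exponent (hw : ∀ a, 1 ≤ w a) {N N' : ℕ} (hNN : N ≤ N')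
    (hF : (∃ K, ∀ a, |F a τ| ≤ K * w a ^ N) ∧
      ∀ e > 0, ∀ᶠ t in 𝓝 τ, ∀ a, |F a t - F a τ| ≤ e * w a ^ N) :
    (∃ K, 0 ≤ K ∧ ∀ a, |F a τ| ≤ K * w a ^ N') ∧
      ∀ e > 0, ∀ᶠ t in 𝓝 τ, ∀ a, |F a t - F a τ| ≤ e * w a ^ N' := by
  obtain ⟨⟨K, hK⟩, hN⟩ := hF
  have hp : ∀ a, w a ^ N ≤ w a ^ N' := fun a => pow_le_pow_right₀ (hw a) hNN
  have h0 : ∀ a, 0 ≤ w a ^ N := fun a => pow_nonneg (zero_le_one.trans (hw a)) _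
  refine ⟨⟨|K|, abs_nonneg _, fun a => (hK a).trans ?_⟩, fun e he => ?_⟩
  · exact mul_le_mul (le_abs_self K) (hp a) (h0 a) (abs_nonneg _)
  · filter_upwards [hN e he] with t ht a
    exact (ht a).trans (mul_le_mul_of_nonneg_left (hp a) he.le)

theorem add (hw : ∀ a, 1 ≤ w a) (hF : WeightedContinuousAt w F τ)
    (hG : WeightedContinuousAt w G τ) :
    WeightedContinuousAt w (fun a t => F a t + G a t) τ := by
  obtain ⟨N₁, h₁⟩ := hF
  obtain ⟨N₂, h₂⟩ := hG
  obtain ⟨⟨K₁, -, hK₁⟩, hN₁⟩ := mono_exponent hw (le_max_left N₁ N₂) h₁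
  obtain ⟨⟨K₂, -, hK₂⟩, hN₂⟩ := mono_exponent hw (le_max_right N₁ N₂) h₂
  refine ⟨max N₁ N₂, ⟨K₁ + K₂, fun a => ?_⟩, fun e he => ?_⟩
  · rw [add_mul]
    exact (abs_add_le _ _).trans (add_le_add (hK₁ a) (hK₂ a))
  · filter_upwards [hN₁ (e / 2) (half_pos he), hN₂ (e / 2) (half_pos he)] with t h1 h2 a
    have : F a t + G a t - (F a τ + G a τ) = (F a t - F a τ) + (G a t - G a τ) := by ring
    rw [this]
    refine (abs_add_le _ _).trans ((add_le_add (h1 a) (h2 a)).trans (le_of_eq (by ring)))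

theorem mul (hw : ∀ a, 1 ≤ w a) (hF : WeightedContinuousAt w F τ)
    (hG : WeightedContinuousAt w G τ) :
    WeightedContinuousAt w (fun a t => F a t * G a t) τ := by
  obtain ⟨N₁, h₁⟩ := hF
  obtain ⟨N₂, h₂⟩ := hG
  obtain ⟨⟨K₁, hK₁0, hK₁⟩, hN₁⟩ := mono_exponent hw le_rfl h₁
  obtain ⟨⟨K₂, hK₂0, hK₂⟩, hN₂⟩ := mono_exponent hw le_rfl h₂
  have hw0 : ∀ N a, 0 ≤ w a ^ N := fun N a => pow_nonneg (zero_le_one.trans (hw a)) _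
  refine ⟨N₁ + N₂, ⟨K₁ * K₂, fun a => ?_⟩, fun e he => ?_⟩
  · rw [abs_mul, pow_add]
    calc |F a τ| * |G a τ| ≤ (K₁ * w a ^ N₁) * (K₂ * w a ^ N₂) :=
          mul_le_mul (hK₁ a) (hK₂ a) (abs_nonneg _) ((abs_nonneg _).trans (hK₁ a))
      _ = _ := by ring
  -- The three error terms add up to $\eta^2+\eta(K_1+K_2)\le\eta(1+K_1+K_2)\le e$, where the first
  -- inequality uses $\eta\le 1$.
  · set η := min 1 (e / (1 + K₁ + K₂)) with hη
    have hD : 0 < 1 + K₁ + K₂ := by positivity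
    have hη0 : 0 < η := lt_min one_pos (div_pos he hD)
    have hη1 : η ≤ 1 := min_le_left _ _
    have hηe : η * (1 + K₁ + K₂) ≤ e := (le_div_iff₀ hD).1 (min_le_right _ _)
    filter_upwards [hN₁ η hη0, hN₂ η hη0] with t h1 h2 a
    have hid : F a t * G a t - F a τ * G a τ = (F a t - F a τ) * (G a t - G a τ) +
        F a τ * (G a t - G a τ) + (F a t - F a τ) * G a τ := by ring
    rw [hid]
    refine (abs_add_le _ _).trans ((add_le_add_left (abs_add_le _ _) _).trans ?_)
    rw [abs_mul, abs_mul, abs_mul, pow_add]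
    have i1 : |F a t - F a τ| * |G a t - G a τ| ≤ (η * w a ^ N₁) * (η * w a ^ N₂) :=
      mul_le_mul (h1 a) (h2 a) (abs_nonneg _) (mul_nonneg hη0.le (hw0 _ _))
    have i2 : |F a τ| * |G a t - G a τ| ≤ (K₁ * w a ^ N₁) * (η * w a ^ N₂) :=
      mul_le_mul (hK₁ a) (h2 a) (abs_nonneg _) (mul_nonneg hK₁0 (hw0 _ _))
    have i3 : |F a t - F a τ| * |G a τ| ≤ (η * w a ^ N₁) * (K₂ * w a ^ N₂) :=
      mul_le_mul (h1 a) (hK₂ a) (abs_nonneg _) (mul_nonneg hη0.le (hw0 _ _))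
    have hW : 0 ≤ w a ^ N₁ * w a ^ N₂ := mul_nonneg (hw0 _ _) (hw0 _ _)
    have hηη : η * η ≤ η * 1 := mul_le_mul_of_nonneg_left hη1 hη0.le
    calc _ ≤ (η * w a ^ N₁) * (η * w a ^ N₂) + (K₁ * w a ^ N₁) * (η * w a ^ N₂) +
          (η * w a ^ N₁) * (K₂ * w a ^ N₂) := add_le_add (add_le_add i1 i2) i3
      _ = (η * η + η * (K₁ + K₂)) * (w a ^ N₁ * w a ^ N₂) := by ring
      _ ≤ e * (w a ^ N₁ * w a ^ N₂) := mul_le_mul_of_nonneg_right (by linarith) hW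

theorem of_continuousAt {c : T → ℝ} (hc : ContinuousAt c τ) :
    WeightedContinuousAt w (fun _ t => c t) τ := by
  refine ⟨0, ⟨|c τ|, fun a => by simp⟩, fun e he => ?_⟩
  filter_upwards [Metric.continuousAt_iff'.1 hc e he] with t ht a
  rw [pow_zero, mul_one]
  exact ht.le

theorem of_bound {φ : α → ℝ} (h : ∃ (N : ℕ) (K : ℝ), ∀ a, |φ a| ≤ K * w a ^ N)
    (hw : ∀ a, 1 ≤ w a) : WeightedContinuousAt w (fun a (_ : T) => φ a) τ := by
  obtain ⟨N, K, hK⟩ := h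
  refine ⟨N, ⟨K, hK⟩, fun e he => Eventually.of_forall fun t a => ?_⟩
  rw [sub_self, abs_zero]
  exact mul_nonneg he.le (pow_nonneg (zero_le_one.trans (hw a)) _)

theorem sum (hw : ∀ a, 1 ≤ w a) {ι : Type*} (s : Finset ι) {F : ι → α → T → ℝ}
    (hF : ∀ k ∈ s, WeightedContinuousAt w (F k) τ) :
    WeightedContinuousAt w (fun a t => ∑ k ∈ s, F k a t) τ := by
  classical
  induction s using Finset.induction_on with
  | empty =>
    simp only [Finset.sum_empty]
    exact of_continuousAt continuousAt_const
  | insert k s hk ih =>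
    simp only [Finset.sum_insert hk]
    exact (hF k (Finset.mem_insert_self _ _)).add hw
      (ih fun l hl => hF l (Finset.mem_insert_of_mem hl))

theorem comp_left {β : Type*} (hF : WeightedContinuousAt w F τ) (g : β → α) :
    WeightedContinuousAt (fun b => w (g b)) (fun b t => F (g b) t) τ := by
  obtain ⟨N, ⟨K, hK⟩, h⟩ := hF
  exact ⟨N, ⟨K, fun b => hK (g b)⟩, fun e he => (h e he).mono fun t ht b => ht (g b)⟩

end WeightedContinuousAt

/-! ### Posterior weights, uniformly in the mixing probabilities. -/

/-- The weights of the components are Lipschitz functions of the component log-densities. -/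
theorem softmax_sub_le {ι : Type*} [Fintype ι] {q x x' : ι → ℝ} (hq : ∀ k, 0 < q k) {e : ℝ}
    (hx : ∀ k, |x k - x' k| ≤ e) (m : ι) :
    q m * Real.exp (x m) / ∑ k, q k * Real.exp (x k) -
      q m * Real.exp (x' m) / ∑ k, q k * Real.exp (x' k) ≤ 2 * e := by
  have hpos : ∀ y : ι → ℝ, 0 < ∑ k, q k * Real.exp (y k) := fun y =>
    Finset.sum_pos (fun k _ => mul_pos (hq k) (Real.exp_pos _)) ⟨m, Finset.mem_univ m⟩
  set W := q m * Real.exp (x m) / ∑ k, q k * Real.exp (x k) with hW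
  have hW1 : W ≤ 1 := (div_le_one (hpos x)).2
    (Finset.single_le_sum (f := fun k => q k * Real.exp (x k))
      (fun k _ => (mul_pos (hq k) (Real.exp_pos _)).le) (Finset.mem_univ m))
  have hW0 : 0 ≤ W := div_nonneg (mul_pos (hq m) (Real.exp_pos _)).le (hpos x).le
  have he : 0 ≤ e := (abs_nonneg _).trans (hx m)
  have h1 : q m * Real.exp (x m) * Real.exp (-e) ≤ q m * Real.exp (x' m) := by
    rw [mul_assoc, ← Real.exp_add]
    refine mul_le_mul_of_nonneg_left (Real.exp_le_exp.2 ?_) (hq m).le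
    linarith [(abs_le.1 (hx m)).2]
  have h2 : ∑ k, q k * Real.exp (x' k) ≤ (∑ k, q k * Real.exp (x k)) * Real.exp e := by
    rw [Finset.sum_mul]
    refine Finset.sum_le_sum fun k _ => ?_
    rw [mul_assoc, ← Real.exp_add]
    refine mul_le_mul_of_nonneg_left (Real.exp_le_exp.2 ?_) (hq k).le
    linarith [(abs_le.1 (hx k)).1]
  -- The numerator and the denominator each change by a factor of at most $e^{\pm e}$. With
  -- $e^{-2e}\ge 1-2e$ and $W\le 1$ the claim follows.
  have h3 : W * Real.exp (-(2 * e)) ≤ q m * Real.exp (x' m) / ∑ k, q k * Real.exp (x' k) := by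
    rw [le_div_iff₀ (hpos x')]
    calc W * Real.exp (-(2 * e)) * ∑ k, q k * Real.exp (x' k)
        ≤ W * Real.exp (-(2 * e)) * ((∑ k, q k * Real.exp (x k)) * Real.exp e) :=
          mul_le_mul_of_nonneg_left h2 (mul_nonneg hW0 (Real.exp_pos _).le)
      _ = (W * ∑ k, q k * Real.exp (x k)) * (Real.exp (-(2 * e)) * Real.exp e) := by ring
      _ = q m * Real.exp (x m) * Real.exp (-e) := by
          rw [hW, div_mul_cancel₀ _ (hpos x).ne', ← Real.exp_add]
          congr 2
          ring
      _ ≤ _ := h1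
  have h4 := Real.add_one_le_exp (-(2 * e))
  nlinarith

/-- The Lipschitz constant does not involve `q`, so the mixing probabilities may vary arbitrarily
with `a`. -/
theorem WeightedContinuousAt.softmax {α T ι : Type*} [TopologicalSpace T] [Fintype ι] {w : α → ℝ}
    (hw : ∀ a, 1 ≤ w a) {τ : T} {x : ι → α → T → ℝ} (hx : ∀ k, WeightedContinuousAt w (x k) τ)
    {q : α → ι → ℝ} (hq : ∀ a k, 0 < q a k) (m : ι) :
    WeightedContinuousAt w (fun a t => q a m * Real.exp (x m a t) /
      ∑ k, q a k * Real.exp (x k a t)) τ := by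
  choose N hN using hx
  have hx' := fun k => mono_exponent hw (Finset.le_sup (f := N) (Finset.mem_univ k)) (hN k)
  refine ⟨Finset.univ.sup N, ⟨1, fun a => ?_⟩, fun e he => ?_⟩
  · have hpos : 0 < ∑ k, q a k * Real.exp (x k a τ) :=
      Finset.sum_pos (fun k _ => mul_pos (hq a k) (Real.exp_pos _)) ⟨m, Finset.mem_univ m⟩
    rw [abs_of_nonneg (div_nonneg (mul_pos (hq a m) (Real.exp_pos _)).le hpos.le), one_mul]
    refine ((div_le_one hpos).2 ?_).trans (one_le_pow₀ (hw a))
    exact Finset.single_le_sum (f := fun k => q a k * Real.exp (x k a τ))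
      (fun k _ => (mul_pos (hq a k) (Real.exp_pos _)).le) (Finset.mem_univ m)
  · have hall := eventually_all.2 fun k => (hx' k).2 (e / 2) (half_pos he)
    filter_upwards [hall] with t ht a
    have h1 := softmax_sub_le (hq a) (fun k => ht k a) m
    have h2 := softmax_sub_le (hq a) (fun k => (abs_sub_comm _ _).trans_le (ht k a)) m
    rw [abs_le]
    constructor <;> linarith

/-! ### Separated expansions in parameter and observation. -/

/-- Finite sums of products of a function of the parameter that is smooth at `τ` and a continuous
function of the observation that has polynomial growth. -/
def SmoothExpansion (τ : Param d M) (F : Obs d → Param d M → ℝ) : Prop :=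
  ∃ (ι : Type) (_ : Fintype ι) (a : ι → Param d M → ℝ) (φ : ι → Obs d → ℝ),
    (∀ k, ContDiffAt ℝ 1 (a k) τ) ∧ (∀ k, Continuous (φ k)) ∧
    (∀ k, ∃ (N : ℕ) (K : ℝ), ∀ z, |φ k z| ≤ K * (1 + ‖z‖) ^ N) ∧
    ∀ z t, F z t = ∑ k, a k t * φ k z

theorem one_le_weight (z : Obs d) : 1 ≤ 1 + ‖z‖ := le_add_of_nonneg_right (norm_nonneg z)

namespace SmoothExpansion

variable {τ : Param d M} {F G : Obs d → Param d M → ℝ}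

theorem of_param {a : Param d M → ℝ} (ha : ContDiffAt ℝ 1 a τ) :
    SmoothExpansion τ fun _ t => a t :=
  ⟨Unit, inferInstance, fun _ => a, fun _ _ => 1, fun _ => ha, fun _ => continuous_const,
    fun _ => ⟨0, 1, fun z => by simp⟩, fun z t => by simp⟩

theorem of_obs {φ : Obs d → ℝ} (hφ : Continuous φ) (hb : ∀ z, |φ z| ≤ ‖z‖) :
    SmoothExpansion τ fun z _ => φ z :=
  ⟨Unit, inferInstance, fun _ _ => 1, fun _ => φ, fun _ => contDiffAt_const, fun _ => hφ,
    fun _ => ⟨1, 1, fun z => (hb z).trans (by simp)⟩, fun z t => by simp⟩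

theorem add (hF : SmoothExpansion τ F) (hG : SmoothExpansion τ G) :
    SmoothExpansion τ fun z t => F z t + G z t := by
  obtain ⟨ι, _, a, φ, ha, hφ, hb, h⟩ := hF
  obtain ⟨ι', _, a', φ', ha', hφ', hb', h'⟩ := hG
  refine ⟨ι ⊕ ι', inferInstance, Sum.elim a a', Sum.elim φ φ', ?_, ?_, ?_, fun z t => ?_⟩
  · rintro (k | k)
    exacts [ha k, ha' k]
  · rintro (k | k)
    exacts [hφ k, hφ' k]
  · rintro (k | k)
    exacts [hb k, hb' k]
  · simp [h, h']

theorem mul (hF : SmoothExpansion τ F) (hG : SmoothExpansion τ G) :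
    SmoothExpansion τ fun z t => F z t * G z t := by
  obtain ⟨ι, _, a, φ, ha, hφ, hb, h⟩ := hF
  obtain ⟨ι', _, a', φ', ha', hφ', hb', h'⟩ := hG
  refine ⟨ι × ι', inferInstance, fun k t => a k.1 t * a' k.2 t, fun k z => φ k.1 z * φ' k.2 z,
    fun k => (ha k.1).mul (ha' k.2), fun k => (hφ k.1).mul (hφ' k.2), fun k => ?_, fun z t => ?_⟩
  · obtain ⟨N, K, hK⟩ := hb k.1
    obtain ⟨N', K', hK'⟩ := hb' k.2
    refine ⟨N + N', K * K', fun z => ?_⟩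
    rw [abs_mul, pow_add, mul_mul_mul_comm]
    exact mul_le_mul (hK z) (hK' z) (abs_nonneg _) ((abs_nonneg _).trans (hK z))
  · simp only [h, h']
    rw [Finset.sum_mul_sum, Fintype.sum_prod_type]
    exact Finset.sum_congr rfl fun k _ => Finset.sum_congr rfl fun l _ => by ring

theorem sum {ι : Type*} (s : Finset ι) {F : ι → Obs d → Param d M → ℝ}
    (hF : ∀ k ∈ s, SmoothExpansion τ (F k)) :
    SmoothExpansion τ fun z t => ∑ k ∈ s, F k z t := by
  classical
  induction s using Finset.induction_on with
  | empty =>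
    simp only [Finset.sum_empty]
    exact of_param contDiffAt_const
  | insert k s hk ih =>
    simp only [Finset.sum_insert hk]
    exact (hF k (Finset.mem_insert_self _ _)).add
      (ih fun l hl => hF l (Finset.mem_insert_of_mem hl))

theorem sub (hF : SmoothExpansion τ F) (hG : SmoothExpansion τ G) :
    SmoothExpansion τ fun z t => F z t - G z t := by
  have := hF.add ((of_param (a := fun _ => (-1 : ℝ)) contDiffAt_const).mul hG)
  simpa [sub_eq_add_neg] using this

theorem weightedContinuousAt (hF : SmoothExpansion τ F) :
    WeightedContinuousAt (fun z => 1 + ‖z‖) F τ := by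
  obtain ⟨ι, _, a, φ, ha, hφ, hb, h⟩ := hF
  have : WeightedContinuousAt (fun z => 1 + ‖z‖) (fun z t => ∑ k, a k t * φ k z) τ :=
    .sum one_le_weight _ fun k _ =>
      (WeightedContinuousAt.of_continuousAt (ha k).continuousAt).mul one_le_weight
        (.of_bound (hb k) one_le_weight)
  exact this.congr (Eventually.of_forall fun t z => (h z t).symm)

theorem continuous (hF : SmoothExpansion τ F) (t : Param d M) : Continuous fun z => F z t := by
  obtain ⟨ι, _, a, φ, ha, hφ, hb, h⟩ := hF
  simp_rw [h]
  exact continuous_finsetSum _ fun k _ => continuous_const.mul (hφ k)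

/-- Only the finitely many coefficients are differentiated. Hence one neighbourhood of `τ` serves
all `z`, and the derivative has the same separated form with coefficients continuous at `τ`. -/
theorem exists_partialDeriv (hF : SmoothExpansion τ F) (i : Fin M × Coord d) :
    ∃ s : Obs d → Param d M → ℝ, WeightedContinuousAt (fun z => 1 + ‖z‖) s τ ∧
      (∀ t, Continuous fun z => s z t) ∧
      ∀ᶠ t in 𝓝 τ, ∀ z, HasDerivAt (fun r => F z (Function.update t i r)) (s z t) (t i) := by
  obtain ⟨ι, _, a, φ, ha, hφ, hb, h⟩ := hF
  refine ⟨fun z t => ∑ k, fderiv ℝ (a k) t (Pi.single i 1) * φ k z, ?_, fun t => ?_, ?_⟩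
  · refine .sum one_le_weight _ fun k _ => ?_
    refine (WeightedContinuousAt.of_continuousAt ?_).mul one_le_weight
        (.of_bound (hb k) one_le_weight)
    have h1 : ContDiffAt ℝ 0 (fderiv ℝ (a k)) τ := (ha k).fderiv_right (by norm_num)
    exact h1.continuousAt.clm_apply continuousAt_const
  · exact continuous_finsetSum _ fun k _ => continuous_const.mul (hφ k)
  · have hall := eventually_all.2 fun k => (ha k).eventually (by simp)
    filter_upwards [hall] with t ht z
    simp_rw [h]
    refine HasDerivAt.fun_sum fun k _ => HasDerivAt.mul_const ?_ _
    have h1 : HasFDerivAt (a k) (fderiv ℝ (a k) t) (Function.update t i (t i)) := by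
      rw [Function.update_eq_self]
      exact ((ht k).differentiableAt one_ne_zero).hasFDerivAt
    exact h1.comp_hasDerivAt (t i) (hasDerivAt_update t i (t i))

end SmoothExpansion

/-! ### Component log-densities and the score. -/

theorem contDiffAt_det {E : Type*} [NormedAddCommGroup E] [NormedSpace ℝ E] {ι : Type*} [Fintype ι]
    [DecidableEq ι] {A : E → Matrix ι ι ℝ} {x : E} {n : WithTop ℕ∞}
    (hA : ∀ i k, ContDiffAt ℝ n (fun y => A y i k) x) : ContDiffAt ℝ n (fun y => (A y).det) x := by
  simp_rw [Matrix.det_apply']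
  exact ContDiffAt.sum fun σ _ => contDiffAt_const.mul (contDiffAt_prod fun i _ => hA _ _)

theorem contDiffAt_inv_apply {E : Type*} [NormedAddCommGroup E] [NormedSpace ℝ E] {ι : Type*}
    [Fintype ι] [DecidableEq ι] {A : E → Matrix ι ι ℝ} {x : E} {n : WithTop ℕ∞}
    (hA : ∀ i k, ContDiffAt ℝ n (fun y => A y i k) x) (hx : (A x).det ≠ 0) (i k : ι) :
    ContDiffAt ℝ n (fun y => (A y)⁻¹ i k) x := by
  -- Cramer's rule reduces the inverse to determinants, which are polynomial in the entries.
  have h : ∀ y, (A y)⁻¹ i k = (A y).det⁻¹ * ((A y).updateRow k (Pi.single i 1)).det := by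
    intro y
    rw [Matrix.inv_def, Matrix.smul_apply, Matrix.adjugate_apply, Ring.inverse_eq_inv', smul_eq_mul]
  simp_rw [h]
  refine ((contDiffAt_det hA).inv hx).mul (contDiffAt_det fun a b => ?_)
  by_cases hak : a = k
  · subst hak
    simp only [Matrix.updateRow_self]
    exact contDiffAt_const
  · simp only [Matrix.updateRow_ne hak]
    exact hA a b

/-- The logarithm of the density of an observation from the `m`-th component. -/
def compLogDensity (m : Fin M) (z : Obs d) (τ : Param d M) : ℝ :=
  -(1 / 2) * Real.log ((2 * Real.pi) ^ d * (regCov τ m).det) +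
    -(1 / 2) * (∑ i, ∑ k, (z.2 i - regMean τ m i) * (regCov τ m)⁻¹ i k *
      (z.2 k - regMean τ m k)) +
    (-(1 / 2) * Real.log (2 * Real.pi * errVar τ m) +
      -(1 / 2) * (errVar τ m)⁻¹ * ((z.1 - linPred z.2 (coef τ m)) * (z.1 - linPred z.2 (coef τ m))))

theorem inv_sqrt_eq_exp {x : ℝ} (hx : 0 < x) : (√x)⁻¹ = Real.exp (-(1 / 2) * Real.log x) := by
  rw [← Real.exp_log (inv_pos.2 (Real.sqrt_pos.2 hx)), Real.log_inv, Real.log_sqrt hx.le]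
  congr 1
  ring

theorem compDensity_eq_exp {τ : Param d M} {m : Fin M} (hv : 0 < errVar τ m)
    (hd : 0 < (regCov τ m).det) (z : Obs d) :
    compDensity τ m z = Real.exp (compLogDensity m z τ) := by
  have hpi := Real.pi_pos
  unfold compDensity compLogDensity normalDensity gaussianPDFReal
  rw [Real.coe_toNNReal _ hv.le, Real.exp_add, Real.exp_add, Real.exp_add,
    inv_sqrt_eq_exp (by positivity), inv_sqrt_eq_exp (by positivity)]
  congr 3
  · ring
  · field_simp
    ring

theorem contDiff_regCov (m : Fin M) (i k : Fin d) {n : WithTop ℕ∞} :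
    ContDiff ℝ n fun t : Param d M => regCov t m i k := by
  simp only [regCov, Matrix.of_apply]
  exact contDiff_apply ℝ ℝ _

theorem contDiff_errVar (m : Fin M) {n : WithTop ℕ∞} :
    ContDiff ℝ n fun t : Param d M => errVar t m := contDiff_apply ℝ ℝ _

theorem contDiff_coef (m : Fin M) (i : Fin d) {n : WithTop ℕ∞} :
    ContDiff ℝ n fun t : Param d M => coef t m i := contDiff_apply ℝ ℝ _

theorem contDiff_regMean (m : Fin M) (i : Fin d) {n : WithTop ℕ∞} :
    ContDiff ℝ n fun t : Param d M => regMean t m i := contDiff_apply ℝ ℝ _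

theorem eventually_nondegenerate {τ : Param d M} (hv : ∀ m, 0 < errVar τ m)
    (hd : ∀ m, 0 < (regCov τ m).det) :
    ∀ᶠ t in 𝓝 τ, ∀ m, 0 < errVar t m ∧ 0 < (regCov t m).det := by
  refine eventually_all.2 fun m => ?_
  have h1 : ContinuousAt (fun t : Param d M => errVar t m) τ :=
    (contDiff_errVar m (n := 0)).continuous.continuousAt
  have h2 : ContinuousAt (fun t : Param d M => (regCov t m).det) τ :=
    (contDiffAt_det (n := 0) fun i k => (contDiff_regCov m i k).contDiffAt).continuousAt
  exact (h1.eventually_const_lt (hv m)).and (h2.eventually_const_lt (hd m))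

/-- Expanding the two quadratic forms gives a polynomial in `z` whose coefficients involve only
logarithms and inverses of quantities that are nonzero at `τ`. -/
theorem smoothExpansion_compLogDensity {τ : Param d M} {m : Fin M} (hv : 0 < errVar τ m)
    (hd : 0 < (regCov τ m).det) : SmoothExpansion τ (compLogDensity m) := by
  have hpi := Real.pi_pos
  have hx : ∀ i, SmoothExpansion τ fun z : Obs d => fun _ => z.2 i := fun i =>
    .of_obs (by fun_prop) fun z => (PiLp.norm_apply_le z.2 i).trans (norm_snd_le z)
  have hy : SmoothExpansion τ fun z : Obs d => fun _ => z.1 :=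
    .of_obs (by fun_prop) fun z => norm_fst_le z
  have hxm : ∀ i, SmoothExpansion τ fun z : Obs d => fun t => z.2 i - regMean t m i := fun i =>
    (hx i).sub (.of_param (contDiff_regMean m i).contDiffAt)
  have hres : SmoothExpansion τ fun z t => z.1 - linPred z.2 (coef t m) := by
    unfold linPred
    exact hy.sub (.sum _ fun i _ => (SmoothExpansion.of_param (contDiff_coef m i).contDiffAt).mul
      (hx i))
  have hC : ∀ i k, ContDiffAt ℝ 1 (fun t : Param d M => regCov t m i k) τ := fun i k =>
    (contDiff_regCov m i k).contDiffAt
  have hE : ContDiffAt ℝ 1 (fun t : Param d M => errVar t m) τ := (contDiff_errVar m).contDiffAt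
  unfold compLogDensity
  refine .add (.add (.of_param ?_) (.mul (.of_param contDiffAt_const)
    (.sum _ fun i _ => .sum _ fun k _ => ((hxm i).mul (.of_param ?_)).mul (hxm k))))
    (.add (.of_param ?_) (.mul (.of_param ?_) (hres.mul hres)))
  · exact contDiffAt_const.mul ((contDiffAt_const.mul (contDiffAt_det hC)).log (by positivity))
  · exact contDiffAt_inv_apply hC hd.ne' i k
  · exact contDiffAt_const.mul ((contDiffAt_const.mul hE).log (by positivity))
  · exact contDiffAt_const.mul (hE.inv hv.ne')

/-- The posterior probability of the `m`-th component. -/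
def posterior (q : Fin M → ℝ) (m : Fin M) (z : Obs d) (τ : Param d M) : ℝ :=
  q m * Real.exp (compLogDensity m z τ) / ∑ k, q k * Real.exp (compLogDensity k z τ)

/-- Near a nondegenerate parameter the score is the posterior mean of the component scores. -/
theorem score_eq_sum_posterior {τ : Param d M}
    (hnd : ∀ᶠ t in 𝓝 τ, ∀ m, 0 < errVar t m ∧ 0 < (regCov t m).det) {z : Obs d}
    {q : Fin M → ℝ} (hq : ∀ m, 0 < q m) (i : Fin M × Coord d) {s : Fin M → ℝ}
    (hs : ∀ m, HasDerivAt (fun r => compLogDensity m z (Function.update τ i r)) (s m) (τ i)) :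
    score z q τ i = ∑ m, posterior q m z τ * s m := by
  have hu : Tendsto (fun r => Function.update τ i r) (𝓝 (τ i)) (𝓝 τ) := by
    have := (hasDerivAt_update τ i (τ i)).continuousAt
    rw [ContinuousAt, Function.update_eq_self] at this
    exact this
  -- The exponential form of the component densities holds only for nondegenerate parameters, but
  -- the derivative depends only on values near `τ i`.
  have heq : (fun r => logLik z q (Function.update τ i r)) =ᶠ[𝓝 (τ i)]
      fun r => Real.log (∑ m, q m * Real.exp (compLogDensity m z (Function.update τ i r))) := by
    filter_upwards [hu.eventually hnd] with r hr
    rw [logLik, mixDensity_eq_sum]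
    simp_rw [compDensity_eq_exp (hr _).1 (hr _).2]
  rcases isEmpty_or_nonempty (Fin M) with hM | hM
  · exact (hM.false i.1).elim
  have hpos : 0 < ∑ k, q k * Real.exp (compLogDensity k z τ) :=
    Finset.sum_pos (fun k _ => mul_pos (hq k) (Real.exp_pos _)) Finset.univ_nonempty
  have hder := (HasDerivAt.fun_sum (u := Finset.univ)
    fun m _ => ((hs m).exp.const_mul (q m))).log (by rw [Function.update_eq_self]; exact hpos.ne')
  rw [score, heq.deriv_eq, hder.deriv, Function.update_eq_self, Finset.sum_div]
  refine Finset.sum_congr rfl fun m _ => ?_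
  rw [posterior]
  ring

theorem exists_score_expansion {τ : Param d M} (hv : ∀ m, 0 < errVar τ m)
    (hd : ∀ m, 0 < (regCov τ m).det) (i : Fin M × Coord d) :
    ∃ s : Fin M → Obs d → Param d M → ℝ,
      (∀ m, WeightedContinuousAt (fun z => 1 + ‖z‖) (s m) τ) ∧
      (∀ m t, Continuous fun z => s m z t) ∧
      ∀ᶠ t in 𝓝 τ, ∀ (z : Obs d) (q : Fin M → ℝ), (∀ m, 0 < q m) →
        score z q t i = ∑ m, posterior q m z t * s m z t := by
  choose s h1 h2 h3 using fun m =>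
    (smoothExpansion_compLogDensity (hv m) (hd m)).exists_partialDeriv i
  refine ⟨s, h1, h2, ?_⟩
  -- The score at `t` differentiates around `t`, so nondegeneracy is needed on a neighbourhood of
  -- `t`, not merely at `t`.
  filter_upwards [(eventually_nondegenerate hv hd).eventually_nhds, eventually_all.2 h3] with
    t ht hs z q hq
  exact score_eq_sum_posterior ht hq i fun m => hs m z

/-- Indexing by pairs of subject and observation makes the estimate uniform over subjects as well as
over observations. -/
theorem weightedContinuousAt_score {τ : Param d M} (hv : ∀ m, 0 < errVar τ m)
    (hd : ∀ m, 0 < (regCov τ m).det) {p : ℕ → Fin M → ℝ} (hp : ∀ j m, 0 < p j m)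
    (i : Fin M × Coord d) :
    WeightedContinuousAt (fun a : ℕ × Obs d => 1 + ‖a.2‖) (fun a t => score a.2 (p a.1) t i) τ := by
  obtain ⟨s, hs, -, h⟩ := exists_score_expansion hv hd i
  have hw : ∀ a : ℕ × Obs d, 1 ≤ 1 + ‖a.2‖ := fun a => one_le_weight a.2
  have hpost : ∀ m, WeightedContinuousAt (fun a : ℕ × Obs d => 1 + ‖a.2‖)
      (fun a t => posterior (p a.1) m a.2 t) τ := fun m =>
    .softmax hw (fun k => (smoothExpansion_compLogDensity (hv k) (hd k)).weightedContinuousAt.comp_left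
      Prod.snd) (fun a => hp a.1) m
  refine (WeightedContinuousAt.sum hw Finset.univ fun m _ =>
    (hpost m).mul hw ((hs m).comp_left Prod.snd)).congr ?_
  filter_upwards [h] with t ht a
  exact (ht a.2 (p a.1) (hp a.1)).symm

theorem continuous_score {τ : Param d M} (hv : ∀ m, 0 < errVar τ m)
    (hd : ∀ m, 0 < (regCov τ m).det) {q : Fin M → ℝ} (hq : ∀ m, 0 < q m) (i : Fin M × Coord d) :
    Continuous fun z => score z q τ i := by
  obtain ⟨s, -, hs, h⟩ := exists_score_expansion hv hd i
  simp_rw [fun z => h.self_of_nhds z q hq]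
  have hl : ∀ m, Continuous fun z => q m * Real.exp (compLogDensity m z τ) := fun m =>
    continuous_const.mul
      (Real.continuous_exp.comp ((smoothExpansion_compLogDensity (hv m) (hd m)).continuous τ))
  refine continuous_finsetSum _ fun m _ => Continuous.mul ?_ (hs m τ)
  exact (hl m).div (continuous_finsetSum _ fun k _ => hl k) fun z => (Finset.sum_pos
    (fun k _ => mul_pos (hq k) (Real.exp_pos _)) ⟨m, Finset.mem_univ m⟩).ne'

/-! ### Moments and integrability, uniform over the mixing probabilities. -/

theorem integrable_weight_compLaw (τ : Param d M) (m : Fin M) (N : ℕ) :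
    Integrable (fun z : Obs d => (1 + ‖z‖) ^ N) (compLaw τ m) := by
  rcases Nat.eq_zero_or_pos N with rfl | hN
  · simp
  have h1 : MemLp (fun z : Obs d => 1 + ‖z‖) (N : ENNReal) (compLaw τ m) :=
    (memLp_const (1 : ℝ)).add (IsGaussian.memLp_id (compLaw τ m) N (by simp)).norm
  have := h1.integrable_norm_pow hN.ne'
  refine this.congr (ae_of_all _ fun z => ?_)
  simp only [Real.norm_eq_abs]
  rw [abs_of_nonneg (by positivity)]

/-- The sum over the components of the `N`-th moments of `1 + ‖z‖`. -/
def weightMoment (τ : Param d M) (N : ℕ) : ℝ :=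
  ∑ m, ∫ z, (1 + ‖z‖) ^ N ∂(compLaw τ m)

theorem weightMoment_nonneg (τ : Param d M) (N : ℕ) : 0 ≤ weightMoment τ N :=
  Finset.sum_nonneg fun _ _ => integral_nonneg fun _ => by positivity

theorem integrable_mixLaw {τ : Param d M} (hS : ∀ m, (regCov τ m).PosSemidef)
    (hdet : ∀ m, (regCov τ m).det ≠ 0) (hv : ∀ m, 0 < errVar τ m) {q : Fin M → ℝ} (hq : ∀ m, 0 ≤ q m) {f : Obs d → ℝ}
    (hf : ∀ m, Integrable f (compLaw τ m)) : Integrable f (mixLaw q τ) := by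
  rw [mixLaw_eq_sum hS hdet hv hq]
  exact integrable_finsetSum_measure.2 fun m _ => (hf m).smul_measure ENNReal.ofReal_ne_top

theorem integral_mixLaw {τ : Param d M} (hS : ∀ m, (regCov τ m).PosSemidef)
    (hdet : ∀ m, (regCov τ m).det ≠ 0) (hv : ∀ m, 0 < errVar τ m) {q : Fin M → ℝ} (hq : ∀ m, 0 ≤ q m) {f : Obs d → ℝ}
    (hf : ∀ m, Integrable f (compLaw τ m)) :
    ∫ z, f z ∂(mixLaw q τ) = ∑ m, q m * ∫ z, f z ∂(compLaw τ m) := by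
  rw [mixLaw_eq_sum hS hdet hv hq, integral_finsetSum_measure fun m _ =>
    (hf m).smul_measure ENNReal.ofReal_ne_top]
  refine Finset.sum_congr rfl fun m _ => ?_
  rw [integral_smul_measure, ENNReal.toReal_ofReal (hq m), smul_eq_mul]

theorem integrable_weight_mixLaw {τ : Param d M} (hS : ∀ m, (regCov τ m).PosSemidef)
    (hdet : ∀ m, (regCov τ m).det ≠ 0) (hv : ∀ m, 0 < errVar τ m) {q : Fin M → ℝ} (hq : ∀ m, 0 ≤ q m) (N : ℕ) :
    Integrable (fun z : Obs d => (1 + ‖z‖) ^ N) (mixLaw q τ) :=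
  integrable_mixLaw hS hdet hv hq fun m => integrable_weight_compLaw τ m N

theorem integral_weight_mixLaw_le {τ : Param d M} (hS : ∀ m, (regCov τ m).PosSemidef)
    (hdet : ∀ m, (regCov τ m).det ≠ 0) (hv : ∀ m, 0 < errVar τ m) {q : Fin M → ℝ} (hq : ∀ m, 0 ≤ q m) (hq1 : ∀ m, q m ≤ 1)
    (N : ℕ) : ∫ z, (1 + ‖z‖) ^ N ∂(mixLaw q τ) ≤ weightMoment τ N := by
  rw [integral_mixLaw hS hdet hv hq fun m => integrable_weight_compLaw τ m N, weightMoment]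
  exact Finset.sum_le_sum fun m _ =>
    mul_le_of_le_one_left (integral_nonneg fun _ => by positivity) (hq1 m)

theorem weightedContinuousAt_score_mul {τ : Param d M} (hv : ∀ m, 0 < errVar τ m)
    (hd : ∀ m, 0 < (regCov τ m).det) {p : ℕ → Fin M → ℝ} (hp : ∀ j m, 0 < p j m)
    (i l : Fin M × Coord d) :
    WeightedContinuousAt (fun a : ℕ × Obs d => 1 + ‖a.2‖)
      (fun a t => score a.2 (p a.1) t i * score a.2 (p a.1) t l) τ :=
  (weightedContinuousAt_score hv hd hp i).mul (fun a => one_le_weight a.2)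
    (weightedContinuousAt_score hv hd hp l)

theorem integrable_of_le_weight {μ : Measure (Obs d)} {f : Obs d → ℝ} (hf : Measurable f) {K : ℝ}
    {N : ℕ} (hb : ∀ z, |f z| ≤ K * (1 + ‖z‖) ^ N)
    (hw : Integrable (fun z : Obs d => (1 + ‖z‖) ^ N) μ) : Integrable f μ :=
  (hw.const_mul K).mono' hf.aestronglyMeasurable (ae_of_all _ hb)

/-! ### Bounds for the Fisher information of one observation. -/

/-- Only the `m₀`-th log-density depends on this coordinate, so the posterior mean collapses to one
explicit term. -/
theorem score_errVar {τ : Param d M} (hv : ∀ m, 0 < errVar τ m)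
    (hd : ∀ m, 0 < (regCov τ m).det) {q : Fin M → ℝ} (hq : ∀ m, 0 < q m) (m₀ : Fin M)
    (z : Obs d) :
    score z q τ (m₀, .inr (.inr (.inr ()))) =
      posterior q m₀ z τ * (-(1 / 2) * (errVar τ m₀)⁻¹ + (1 / 2) *
        ((errVar τ m₀)⁻¹ ^ 2) * ((z.1 - linPred z.2 (coef τ m₀)) ^ 2)) := by
  set i : Fin M × Coord d := (m₀, .inr (.inr (.inr ()))) with hi
  have hcoef : ∀ m r, coef (Function.update τ i r) m = coef τ m := by
    intro m r
    ext k
    simp [coef, hi]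
  have hmean : ∀ m r, regMean (Function.update τ i r) m = regMean τ m := by
    intro m r
    ext k
    simp [regMean, hi]
  have hcov : ∀ m r, regCov (Function.update τ i r) m = regCov τ m := by
    intro m r
    ext k l
    simp [regCov, hi]
  have hvar0 : ∀ r, errVar (Function.update τ i r) m₀ = r := by
    intro r
    simp [errVar, hi]
  have hvar1 : ∀ m, m ≠ m₀ → ∀ r, errVar (Function.update τ i r) m = errVar τ m := by
    intro m hm r
    simp [errVar, hi, hm]
  set s : Fin M → ℝ := Pi.single m₀ (-(1 / 2) * (errVar τ m₀)⁻¹ + (1 / 2) *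
        ((errVar τ m₀)⁻¹ ^ 2) * ((z.1 - linPred z.2 (coef τ m₀)) ^ 2)) with hs
  have hder : ∀ m, HasDerivAt (fun r => compLogDensity m z (Function.update τ i r)) (s m)
      (τ i) := by
    intro m
    by_cases hm : m = m₀
    · subst hm
      have hτ : τ i = errVar τ m := rfl
      have hpos := hv m
      have hpi := Real.pi_pos
      simp only [compLogDensity, hcoef, hmean, hcov, hvar0, hs, Pi.single_eq_same]
      rw [hτ]
      have h1 : HasDerivAt (fun r : ℝ => Real.log (2 * Real.pi * r)) (errVar τ m)⁻¹
          (errVar τ m) := by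
        have := ((hasDerivAt_id (errVar τ m)).const_mul (2 * Real.pi)).log (by simp; positivity)
        refine this.congr_deriv ?_
        change 2 * Real.pi * 1 / (2 * Real.pi * errVar τ m) = (errVar τ m)⁻¹
        field_simp
      have h2 : HasDerivAt (fun r : ℝ => r⁻¹) (-(errVar τ m ^ 2)⁻¹) (errVar τ m) :=
        hasDerivAt_inv hpos.ne'
      have h3 := ((h1.const_mul (-(1 / 2))).add ((h2.const_mul (-(1 / 2))).mul_const
        ((z.1 - linPred z.2 (coef τ m)) * (z.1 - linPred z.2 (coef τ m))))).const_add
        (-(1 / 2) * Real.log ((2 * Real.pi) ^ d * (regCov τ m).det) +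
          -(1 / 2) * (∑ i, ∑ k, (z.2 i - regMean τ m i) * (regCov τ m)⁻¹ i k *
          (z.2 k - regMean τ m k)))
      refine h3.congr_deriv ?_
      ring
    · simp only [compLogDensity, hcoef, hmean, hcov, hvar1 m hm, hs, Pi.single_eq_of_ne hm]
      exact hasDerivAt_const _ _
  rw [score_eq_sum_posterior (eventually_nondegenerate hv hd) hq i hder,
    Finset.sum_eq_single m₀ (fun m _ hm => by rw [hs, Pi.single_eq_of_ne hm, mul_zero])
      (fun h => (h (Finset.mem_univ _)).elim), hs, Pi.single_eq_same]

/-- The explicit factor is common to both sides. Among the posterior weights, `q` has numerator at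
least `c` times, and denominator at most, that for unit weights. The comparison score no longer
depends on the subject. -/
theorem mul_score_sq_le {τ : Param d M} (hv : ∀ m, 0 < errVar τ m)
    (hd : ∀ m, 0 < (regCov τ m).det) {q : Fin M → ℝ} {c : ℝ} (hc : 0 < c)
    (hq : ∀ m, c < q m) (hq1 : ∀ m, q m ≤ 1) (m₀ : Fin M) (z : Obs d) :
    c ^ 2 * score z (fun _ => 1) τ (m₀, .inr (.inr (.inr ()))) ^ 2 ≤
      score z q τ (m₀, .inr (.inr (.inr ()))) ^ 2 := by
  have hq0 : ∀ m, 0 < q m := fun m => hc.trans (hq m)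
  rw [score_errVar hv hd hq0, score_errVar hv hd fun _ => one_pos, mul_pow, mul_pow, ← mul_assoc,
    ← mul_pow]
  refine mul_le_mul_of_nonneg_right ?_ (sq_nonneg _)
  have hpos : ∀ r : Fin M → ℝ, (∀ m, 0 < r m) →
      0 < ∑ k, r k * Real.exp (compLogDensity k z τ) := fun r hr =>
    Finset.sum_pos (fun k _ => mul_pos (hr k) (Real.exp_pos _)) ⟨m₀, Finset.mem_univ _⟩
  have hp1 := hpos (fun _ => 1) fun _ => one_pos
  have hpq := hpos q hq0
  refine pow_le_pow_left₀ (mul_nonneg hc.le (div_nonneg (by positivity) hp1.le)) ?_ 2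
  unfold posterior
  rw [← mul_div_assoc, one_mul]
  refine div_le_div₀ (mul_pos (hq0 _) (Real.exp_pos _)).le
    (mul_le_mul_of_nonneg_right (hq m₀).le (Real.exp_pos _).le) hpq ?_
  exact Finset.sum_le_sum fun k _ => mul_le_mul_of_nonneg_right (hq1 k) (Real.exp_pos _).le

theorem integrable_score_mul_compLaw {τ : Param d M} (hv : ∀ m, 0 < errVar τ m)
    (hd : ∀ m, 0 < (regCov τ m).det) {q : Fin M → ℝ} (hq : ∀ m, 0 < q m) (i l : Fin M × Coord d)
    (m : Fin M) : Integrable (fun z => score z q τ i * score z q τ l) (compLaw τ m) := by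
  obtain ⟨N, ⟨K, hK⟩, -⟩ := weightedContinuousAt_score_mul hv hd (p := fun _ => q) (fun _ => hq) i l
  exact integrable_of_le_weight
    ((continuous_score hv hd hq i).mul (continuous_score hv hd hq l)).measurable
    (fun z => hK (0, z)) (integrable_weight_compLaw τ m N)

/-- A vanishing integral would force the continuous score to vanish almost everywhere for the
component law, whose density is positive; hence Lebesgue almost everywhere, and so identically. -/
theorem integral_score_errVar_sq_pos {τ : Param d M} (hS : ∀ m, (regCov τ m).PosSemidef)
    (hdet : ∀ m, (regCov τ m).det ≠ 0) (hv : ∀ m, 0 < errVar τ m) (hd : ∀ m, 0 < (regCov τ m).det)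
    {q : Fin M → ℝ} (hq : ∀ m, 0 < q m) (m₀ : Fin M) :
    0 < ∫ z, score z q τ (m₀, .inr (.inr (.inr ()))) * score z q τ (m₀, .inr (.inr (.inr ())))
      ∂(compLaw τ m₀) := by
  set i : Fin M × Coord d := (m₀, .inr (.inr (.inr ()))) with hi
  have hnn : ∀ z, 0 ≤ score z q τ i * score z q τ i := fun z => mul_self_nonneg _
  refine lt_of_le_of_ne (integral_nonneg hnn) fun h0 => ?_
  have hc := (continuous_score hv hd hq i).mul (continuous_score hv hd hq i)
  have hae := (integral_eq_zero_iff_of_nonneg hnn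
    (integrable_score_mul_compLaw hv hd hq i i m₀)).1 h0.symm
  have hac : (volume : Measure (Obs d)) ≪ compLaw τ m₀ := by
    rw [compLaw_eq_withDensity (hS m₀) (hdet m₀) (hv m₀)]
    refine withDensity_absolutelyContinuous' (measurable_compDensity τ m₀).ennreal_ofReal.aemeasurable
      (ae_of_all _ fun z => ?_)
    simpa using compDensity_pos (hv m₀) (hd m₀) z
  -- At the origin the residual is zero, so the score there is the posterior weight times
  -- $-1/(2\sigma_{m_0}^2)$, which is nonzero.
  have hz := congrFun ((Continuous.ae_eq_iff_eq (μ := (volume : Measure (Obs d))) hc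
    continuous_zero).1 (hac.ae_eq hae)) (0, 0)
  have hpost : 0 < posterior q m₀ ((0, 0) : Obs d) τ :=
    div_pos (mul_pos (hq _) (Real.exp_pos _)) (Finset.sum_pos
      (fun k _ => mul_pos (hq k) (Real.exp_pos _)) ⟨m₀, Finset.mem_univ _⟩)
  have hlin : linPred (0 : EuclideanSpace ℝ (Fin d)) (coef τ m₀) = 0 := by simp [linPred]
  have hs := score_errVar hv hd hq m₀ ((0, 0) : Obs d)
  simp only [hlin, sub_zero, ne_eq, OfNat.ofNat_ne_zero, not_false_eq_true, zero_pow, mul_zero,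
    add_zero] at hs
  have hne : score ((0, 0) : Obs d) q τ i ≠ 0 := by
    rw [hi, hs]
    exact mul_ne_zero hpost.ne' (mul_ne_zero (by norm_num) (inv_ne_zero (hv m₀).ne'))
  exact hne (mul_self_eq_zero.1 hz)

theorem exists_le_fisherOne {τ : Param d M} (hS : ∀ m, (regCov τ m).PosSemidef)
    (hdet : ∀ m, (regCov τ m).det ≠ 0) (hv : ∀ m, 0 < errVar τ m) (hd : ∀ m, 0 < (regCov τ m).det)
    {c : ℝ} (hc : 0 < c) (m₀ : Fin M) :
    ∃ c₀ > 0, ∀ q : Fin M → ℝ, (∀ m, c < q m) → (∀ m, q m ≤ 1) →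
      c₀ ≤ fisherOne q τ (m₀, .inr (.inr (.inr ()))) (m₀, .inr (.inr (.inr ()))) := by
  have hpos := integral_score_errVar_sq_pos hS hdet hv hd (q := fun _ => 1) (fun _ => one_pos) m₀
  set i : Fin M × Coord d := (m₀, .inr (.inr (.inr ()))) with hi
  have hint1 := fun m => integrable_score_mul_compLaw hv hd (q := fun _ => 1) (fun _ => one_pos) i i m
  -- One factor `c` comes from keeping only component `m₀` of the mixture law, and `c ^ 2` from
  -- passing to unit weights in the squared score.
  refine ⟨c * (c ^ 2 * ∫ z, score z (fun _ => 1) τ i * score z (fun _ => 1) τ i ∂(compLaw τ m₀)),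
    by positivity, fun q hq hq1 => ?_⟩
  have hq0 : ∀ m, 0 < q m := fun m => hc.trans (hq m)
  have hintq := fun m => integrable_score_mul_compLaw hv hd hq0 i i m
  rw [fisherOne, Matrix.of_apply, integral_mixLaw hS hdet hv (fun m => (hq0 m).le) hintq]
  refine le_trans ?_ (Finset.single_le_sum (f := fun m => q m * ∫ z, score z q τ i * score z q τ i
    ∂(compLaw τ m)) (fun m _ => mul_nonneg (hq0 m).le (integral_nonneg fun z => mul_self_nonneg _))
    (Finset.mem_univ m₀))
  refine mul_le_mul (hq m₀).le ?_ (by positivity) (hq0 m₀).le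
  rw [← integral_const_mul]
  refine integral_mono ((hint1 m₀).const_mul _) (hintq m₀) fun z => ?_
  have := mul_score_sq_le hv hd hc hq hq1 m₀ z
  simpa only [sq (score _ _ _ _)] using this

theorem exists_abs_fisherOne_le {τ : Param d M} (hS : ∀ m, (regCov τ m).PosSemidef)
    (hdet : ∀ m, (regCov τ m).det ≠ 0) (hv : ∀ m, 0 < errVar τ m) (hd : ∀ m, 0 < (regCov τ m).det)
    {p : ℕ → Fin M → ℝ} (hp : ∀ j m, 0 < p j m) (hp1 : ∀ j m, p j m ≤ 1) (i l : Fin M × Coord d) :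
    ∃ B, ∀ j, |fisherOne (p j) τ i l| ≤ B := by
  obtain ⟨N, ⟨K, hK⟩, -⟩ := weightedContinuousAt_score_mul hv hd hp i l
  have hK0 : 0 ≤ K := by
    have := (abs_nonneg _).trans (hK (0, 0))
    simpa using this
  refine ⟨K * weightMoment τ N, fun j => ?_⟩
  have hp0 : ∀ m, 0 ≤ p j m := fun m => (hp j m).le
  rw [fisherOne, Matrix.of_apply]
  calc |∫ z, score z (p j) τ i * score z (p j) τ l ∂(mixLaw (p j) τ)|
      ≤ ∫ z, K * (1 + ‖z‖) ^ N ∂(mixLaw (p j) τ) :=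
        norm_integral_le_of_norm_le (f := fun z => score z (p j) τ i * score z (p j) τ l)
          ((integrable_weight_mixLaw hS hdet hv hp0 N).const_mul K)
          (ae_of_all _ fun z => hK (j, z))
    _ ≤ K * weightMoment τ N := by
        rw [integral_const_mul]
        exact mul_le_mul_of_nonneg_left (integral_weight_mixLaw_le hS hdet hv hp0 (hp1 j) N) hK0

/-! ### The quadratic-form norm against matrix entries, and linear growth of the information. -/

section QuadNorm

variable {ι : Type*} [Fintype ι] (A : Matrix ι ι ℝ)

theorem abs_quadForm_le {u : EuclideanSpace ℝ ι} (hu : ‖u‖ = 1) :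
    |∑ i, ∑ l, u i * A i l * u l| ≤ ∑ i, ∑ l, |A i l| := by
  have h1 : ∀ i, |u i| ≤ 1 := fun i => hu ▸ PiLp.norm_apply_le u i
  refine (Finset.abs_sum_le_sum_abs _ _).trans (Finset.sum_le_sum fun i _ =>
    (Finset.abs_sum_le_sum_abs _ _).trans (Finset.sum_le_sum fun l _ => ?_))
  rw [abs_mul, abs_mul]
  calc |u i| * |A i l| * |u l| ≤ 1 * |A i l| * 1 := by
        gcongr
        exacts [h1 i, h1 l]
    _ = |A i l| := by ring

theorem quadNorm_le_sum : quadNorm A ≤ ∑ i, ∑ l, |A i l| := by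
  refine Real.sSup_le ?_ (Finset.sum_nonneg fun i _ => Finset.sum_nonneg fun l _ => abs_nonneg _)
  rintro r ⟨u, hu, rfl⟩
  exact abs_quadForm_le A hu

theorem quadNorm_nonneg : 0 ≤ quadNorm A := by
  refine Real.sSup_nonneg ?_
  rintro r ⟨u, -, rfl⟩
  exact abs_nonneg _

theorem abs_diag_le_quadNorm (i : ι) : |A i i| ≤ quadNorm A := by
  classical
  refine le_csSup ⟨∑ i, ∑ l, |A i l|, ?_⟩ ⟨EuclideanSpace.single i 1, by simp, ?_⟩
  · rintro r ⟨u, hu, rfl⟩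
    exact abs_quadForm_le A hu
  · congr 1
    simp

end QuadNorm

theorem fisher_apply (p : ℕ → Fin M → ℝ) (n : ℕ) (τ : Param d M) (i l : Fin M × Coord d) :
    fisher p n τ i l = ∑ j ∈ Finset.range n, fisherOne (p j) τ i l := by
  rw [fisher, Matrix.sum_apply]

theorem exists_quadNorm_fisher_bounds {τ : Param d M} (hS : ∀ m, (regCov τ m).PosSemidef)
    (hdet : ∀ m, (regCov τ m).det ≠ 0) (hv : ∀ m, 0 < errVar τ m) (hd : ∀ m, 0 < (regCov τ m).det)
    {p : ℕ → Fin M → ℝ} {c : ℝ} (hc : 0 < c) (hp : ∀ j m, c < p j m) (hp1 : ∀ j m, p j m ≤ 1)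
    (m₀ : Fin M) :
    ∃ c₀ C₁ : ℝ, 0 < c₀ ∧ c₀ < C₁ ∧ ∀ n : ℕ, 1 ≤ n →
      c₀ * n ≤ quadNorm (fisher p n τ) ∧ quadNorm (fisher p n τ) ≤ C₁ * n := by
  obtain ⟨c₀, hc₀, hlow⟩ := exists_le_fisherOne hS hdet hv hd hc m₀
  choose B hB using exists_abs_fisherOne_le hS hdet hv hd (fun j m => hc.trans (hp j m)) hp1
  have hB0 : 0 ≤ ∑ i, ∑ l, B i l := Finset.sum_nonneg fun i _ => Finset.sum_nonneg fun l _ =>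
    (abs_nonneg _).trans (hB i l 0)
  -- The entrywise bounds alone would do for the upper estimate; the summand `c₀ + 1` secures the
  -- strict inequality between the two constants.
  refine ⟨c₀, c₀ + 1 + ∑ i, ∑ l, B i l, hc₀, by linarith, fun n _ => ⟨?_, ?_⟩⟩
  · refine le_trans ?_ (abs_diag_le_quadNorm _ (m₀, .inr (.inr (.inr ()))))
    refine le_trans ?_ (le_abs_self _)
    rw [fisher_apply]
    calc c₀ * n = ∑ _j ∈ Finset.range n, c₀ := by simp [mul_comm]
      _ ≤ _ := Finset.sum_le_sum fun j _ => hlow (p j) (hp j) (hp1 j)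
  · have h1 : ∀ i l, |fisher p n τ i l| ≤ n * B i l := by
      intro i l
      rw [fisher_apply]
      refine (Finset.abs_sum_le_sum_abs _ _).trans ((Finset.sum_le_sum fun j _ =>
        hB i l j).trans (by simp))
    calc quadNorm (fisher p n τ) ≤ ∑ i, ∑ l, |fisher p n τ i l| := quadNorm_le_sum _
      _ ≤ ∑ i, ∑ l, n * B i l := Finset.sum_le_sum fun i _ => Finset.sum_le_sum fun l _ => h1 i l
      _ = (∑ i, ∑ l, B i l) * n := by simp_rw [← Finset.mul_sum, mul_comm]
      _ ≤ (c₀ + 1 + ∑ i, ∑ l, B i l) * n := by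
          gcongr
          linarith

/-! ### Convergence in probability to zero and a weak law of large numbers. -/

theorem tendstoInMeasure_zero_iff {Ω : Type*} [MeasurableSpace Ω] {P : Measure Ω}
    {f : ℕ → Ω → ℝ} : TendstoInMeasure P f atTop (fun _ => (0 : ℝ)) ↔
      ∀ δ > 0, Tendsto (fun n => P {ω | δ ≤ |f n ω|}) atTop (𝓝 0) := by
  simp [tendstoInMeasure_iff_norm]

/-- Monotonicity of the outer measure is enough, so the estimators and what is built from them need
not be measurable. -/
theorem tendstoInMeasure_zero_of_abs_le {Ω : Type*} [MeasurableSpace Ω] {P : Measure Ω}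
    {f g : ℕ → Ω → ℝ} (hg : TendstoInMeasure P g atTop (fun _ => (0 : ℝ)))
    (h : ∀ n ω, |f n ω| ≤ g n ω) : TendstoInMeasure P f atTop (fun _ => (0 : ℝ)) := by
  rw [tendstoInMeasure_zero_iff] at hg ⊢
  intro δ hδ
  refine tendsto_of_tendsto_of_tendsto_of_le_of_le tendsto_const_nhds (hg δ hδ)
    (fun n => zero_le) fun n => measure_mono fun ω hω => ?_
  exact (show δ ≤ |f n ω| from hω).trans ((h n ω).trans (le_abs_self _))

theorem tendstoInMeasure_zero_add {Ω : Type*} [MeasurableSpace Ω] {P : Measure Ω}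
    {f g : ℕ → Ω → ℝ} (hf : TendstoInMeasure P f atTop (fun _ => (0 : ℝ)))
    (hg : TendstoInMeasure P g atTop (fun _ => (0 : ℝ))) :
    TendstoInMeasure P (fun n ω => f n ω + g n ω) atTop (fun _ => (0 : ℝ)) := by
  rw [tendstoInMeasure_zero_iff] at hf hg ⊢
  intro δ hδ
  have hsum := (hf (δ / 2) (half_pos hδ)).add (hg (δ / 2) (half_pos hδ))
  rw [add_zero] at hsum
  refine tendsto_of_tendsto_of_tendsto_of_le_of_le tendsto_const_nhds hsum
    (fun n => zero_le) fun n => (measure_mono fun ω hω => ?_).trans (measure_union_le _ _)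
  by_contra hcon
  simp only [Set.mem_union, Set.mem_ofPred_eq, not_or, not_le] at hcon
  have h1 : δ ≤ |f n ω + g n ω| := hω
  have h2 := abs_add_le (f n ω) (g n ω)
  linarith [hcon.1, hcon.2]

theorem tendstoInMeasure_zero_sum {Ω ι : Type*} [MeasurableSpace Ω] {P : Measure Ω}
    (s : Finset ι) {f : ι → ℕ → Ω → ℝ}
    (hf : ∀ k ∈ s, TendstoInMeasure P (f k) atTop (fun _ => (0 : ℝ))) :
    TendstoInMeasure P (fun n ω => ∑ k ∈ s, f k n ω) atTop (fun _ => (0 : ℝ)) := by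
  classical
  induction s using Finset.induction_on with
  | empty =>
    rw [tendstoInMeasure_zero_iff]
    intro δ hδ
    simp [not_le.2 hδ]
  | insert k s hk ih =>
    simp only [Finset.sum_insert hk]
    exact tendstoInMeasure_zero_add (hf k (Finset.mem_insert_self _ _))
      (ih fun l hl => hf l (Finset.mem_insert_of_mem hl))

/-- The weak law of large numbers for independent variables with bounded second moments. -/
theorem tendstoInMeasure_mean_sub_integral {Ω : Type*} [MeasurableSpace Ω] {P : Measure Ω}
    [IsProbabilityMeasure P] {Z : ℕ → Ω → ℝ} (hind : Pairwise fun j k => IndepFun (Z j) (Z k) P)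
    (hL2 : ∀ j, MemLp (Z j) 2 P) {V : ℝ} (hV : ∀ j, variance (Z j) P ≤ V) :
    TendstoInMeasure P (fun (n : ℕ) ω => (1 / (n : ℝ)) *
      |∑ j ∈ Finset.range n, ((∫ ω', Z j ω' ∂P) - Z j ω)|) atTop (fun _ => (0 : ℝ)) := by
  rw [tendstoInMeasure_zero_iff]
  intro δ hδ
  have hlim : Tendsto (fun n : ℕ => ENNReal.ofReal (V / δ ^ 2 * (1 / (n : ℝ)))) atTop (𝓝 0) := by
    have h1 := (tendsto_one_div_atTop_nhds_zero_nat (𝕜 := ℝ)).const_mul (V / δ ^ 2)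
    rw [mul_zero] at h1
    simpa using ENNReal.tendsto_ofReal h1
  refine tendsto_of_tendsto_of_tendsto_of_le_of_le' tendsto_const_nhds hlim
    (Eventually.of_forall fun n => zero_le) ?_
  filter_upwards [eventually_gt_atTop 0] with n hn
  have hn' : (0 : ℝ) < n := Nat.cast_pos.2 hn
  have hmem : MemLp (∑ j ∈ Finset.range n, Z j) 2 P := memLp_finsetSum' _ fun j _ => hL2 j
  -- Chebyshev at distance $\delta n$; the variance of the sum is at most $nV$, which leaves
  -- $V/(\delta^2n)$.
  have hch := meas_ge_le_variance_div_sq hmem (mul_pos hδ hn')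
  have hvar : variance (∑ j ∈ Finset.range n, Z j) P ≤ n * V := by
    rw [IndepFun.variance_sum (fun j _ => hL2 j) fun j _ k _ hjk => hind hjk]
    exact (Finset.sum_le_sum fun j _ => hV j).trans (by simp)
  have hint : ∫ ω', (∑ j ∈ Finset.range n, Z j) ω' ∂P =
      ∑ j ∈ Finset.range n, ∫ ω', Z j ω' ∂P := by
    simp only [Finset.sum_apply]
    exact integral_finsetSum _ fun j _ => (hL2 j).integrable one_le_two
  refine (measure_mono fun ω hω => ?_).trans (hch.trans (ENNReal.ofReal_le_ofReal ?_))
  · have h1 : δ ≤ |((1 / (n : ℝ)) * |∑ j ∈ Finset.range n, ((∫ ω', Z j ω' ∂P) - Z j ω)|)| := hω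
    rw [abs_mul, abs_abs, abs_of_pos (one_div_pos.2 hn'), one_div, inv_mul_eq_div,
      le_div_iff₀ hn', Finset.sum_sub_distrib, abs_sub_comm] at h1
    rw [Set.mem_ofPred_eq, hint, Finset.sum_apply]
    exact h1
  · calc variance (∑ j ∈ Finset.range n, Z j) P / (δ * n) ^ 2 ≤ n * V / (δ * n) ^ 2 := by gcongr
      _ = V / δ ^ 2 * (1 / n) := by field_simp

/-! ### The sample: law of an observation and consistency of the empirical information. -/

variable {Ω : Type*} [MeasurableSpace Ω] {P : Measure Ω} {p : ℕ → Fin M → ℝ}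
  {τ : Param d M} {κ : ℕ → Ω → Fin M} {X : ℕ → Ω → EuclideanSpace ℝ (Fin d)} {ε : ℕ → Ω → ℝ}

theorem measurable_observe_triple (τ : Param d M) :
    Measurable fun v : Fin M × EuclideanSpace ℝ (Fin d) × ℝ => observe τ v.1 v.2.1 v.2.2 :=
  measurable_from_prod_countable_right fun m => measurable_observe τ m

theorem IsNormalModel.measurable_observe (h : IsNormalModel P p τ κ X ε) (j : ℕ) :
    Measurable fun ω => observe τ (κ j ω) (X j ω) (ε j ω) :=
  (measurable_observe_triple τ).comp ((h.measurable_component j).prodMk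
    ((h.measurable_regressors j).prodMk (h.measurable_error j)))

theorem IsNormalModel.indepFun_observe (h : IsNormalModel P p τ κ X ε) :
    iIndepFun (fun j ω => observe τ (κ j ω) (X j ω) (ε j ω)) P :=
  h.indep_subjects.comp (fun _ v => observe τ v.1 v.2.1 v.2.2) fun _ =>
    measurable_observe_triple τ

theorem IsNormalModel.measure_component [IsProbabilityMeasure P] (h : IsNormalModel P p τ κ X ε)
    (j : ℕ) (m : Fin M) : P (κ j ⁻¹' {m}) = ENNReal.ofReal (p j m) := by
  rw [← h.mixing_prob j m, ofReal_measureReal]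

theorem IsNormalModel.mixing_prob_le_one [IsProbabilityMeasure P] (h : IsNormalModel P p τ κ X ε)
    (j : ℕ) (m : Fin M) : p j m ≤ 1 :=
  h.mixing_prob j m ▸ measureReal_le_one

/-- Law of total probability over the component number. Every component has positive probability, so
all the conditional laws of the model are available. -/
theorem IsNormalModel.map_observe_eq_mixLaw [IsProbabilityMeasure P]
    (h : IsNormalModel P p τ κ X ε) (hS : ∀ m, (regCov τ m).PosSemidef)
    (hdet : ∀ m, (regCov τ m).det ≠ 0) (hv : ∀ m, 0 < errVar τ m) (hp : ∀ j m, 0 < p j m) (j : ℕ) :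
    P.map (fun ω => observe τ (κ j ω) (X j ω) (ε j ω)) = mixLaw (p j) τ := by
  have hm := h.measurable_observe j
  have hX := h.measurable_regressors j
  have hε := h.measurable_error j
  rw [mixLaw_eq_sum hS hdet hv fun m => (hp j m).le]
  conv_lhs => rw [← sum_meas_smul_cond_fiber (h.measurable_component j) P]
  rw [Measure.map_finset_sum hm.aemeasurable]
  refine Finset.sum_congr rfl fun m _ => ?_
  have hne : P (κ j ⁻¹' {m}) ≠ 0 := by simpa [h.measure_component] using hp j m
  have : IsProbabilityMeasure (cond P (κ j ⁻¹' {m})) := cond_isProbabilityMeasure hne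
  rw [Measure.map_smul, h.measure_component j m]
  congr 1
  have hae : (fun ω => observe τ (κ j ω) (X j ω) (ε j ω)) =ᵐ[cond P (κ j ⁻¹' {m})]
      fun ω => observe τ m (X j ω) (ε j ω) := by
    filter_upwards [ae_cond_mem (h.measurable_component j (measurableSet_singleton m))] with ω hω
    rw [show κ j ω = m from hω]
  rw [Measure.map_congr hae, compLaw, ← h.regressor_law j m hne, ← h.error_law j m hne,
    ← (h.cond_indep j m hne).map_prod_eq_prod_map_map hX.aemeasurable hε.aemeasurable,
    Measure.map_map (MixReg.measurable_observe τ m) (hX.prodMk hε)]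
  rfl

theorem IsNormalModel.integral_observe [IsProbabilityMeasure P]
    (h : IsNormalModel P p τ κ X ε) (hS : ∀ m, (regCov τ m).PosSemidef)
    (hdet : ∀ m, (regCov τ m).det ≠ 0) (hv : ∀ m, 0 < errVar τ m) (hp : ∀ j m, 0 < p j m) (j : ℕ)
    {f : Obs d → ℝ} (hf : Measurable f) :
    ∫ ω, f (observe τ (κ j ω) (X j ω) (ε j ω)) ∂P = ∫ z, f z ∂(mixLaw (p j) τ) := by
  rw [← h.map_observe_eq_mixLaw hS hdet hv hp j, integral_map (h.measurable_observe j).aemeasurable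
    hf.aestronglyMeasurable]

theorem IsNormalModel.integrable_observe [IsProbabilityMeasure P]
    (h : IsNormalModel P p τ κ X ε) (hS : ∀ m, (regCov τ m).PosSemidef)
    (hdet : ∀ m, (regCov τ m).det ≠ 0) (hv : ∀ m, 0 < errVar τ m) (hp : ∀ j m, 0 < p j m) (j : ℕ)
    {f : Obs d → ℝ} (hf : Integrable f (mixLaw (p j) τ)) :
    Integrable (fun ω => f (observe τ (κ j ω) (X j ω) (ε j ω))) P := by
  rw [← h.map_observe_eq_mixLaw hS hdet hv hp j] at hf
  exact hf.comp_measurable (h.measurable_observe j)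

/-- The empirical information at the true parameter is close to the Fisher information. -/
theorem IsNormalModel.tendstoInMeasure_fisher_sub [IsProbabilityMeasure P]
    (h : IsNormalModel P p τ κ X ε) (hS : ∀ m, (regCov τ m).PosSemidef)
    (hdet : ∀ m, (regCov τ m).det ≠ 0) (hv : ∀ m, 0 < errVar τ m) (hd : ∀ m, 0 < (regCov τ m).det)
    (hp : ∀ j m, 0 < p j m) (i l : Fin M × Coord d) :
    TendstoInMeasure P (fun (n : ℕ) ω => (1 / (n : ℝ)) *
      |fisher p n τ i l - empInfo p (fun j => observe τ (κ j ω) (X j ω) (ε j ω)) n τ i l|)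
      atTop (fun _ => (0 : ℝ)) := by
  obtain ⟨N, ⟨K, hK⟩, -⟩ := weightedContinuousAt_score_mul hv hd hp i l
  set g : ℕ → Obs d → ℝ := fun j z => score z (p j) τ i * score z (p j) τ l with hg
  have hgm : ∀ j, Measurable (g j) := fun j =>
    ((continuous_score hv hd (hp j) i).mul (continuous_score hv hd (hp j) l)).measurable
  have hgb : ∀ j z, |g j z| ≤ K * (1 + ‖z‖) ^ N := fun j z => hK (j, z)
  -- Squaring doubles the exponent of the weight, so the second moments are bounded uniformly in `j`
  -- by a moment of order `N * 2`.
  have hgb2 : ∀ j z, |g j z ^ 2| ≤ K ^ 2 * (1 + ‖z‖) ^ (N * 2) := fun j z => by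
    rw [abs_pow, pow_mul, ← mul_pow]
    exact pow_le_pow_left₀ (abs_nonneg _) (hgb j z) 2
  have hp0 : ∀ j m, 0 ≤ p j m := fun j m => (hp j m).le
  have hw := fun j => integrable_weight_mixLaw hS hdet hv (hp0 j) (N * 2)
  have hint2 : ∀ j, Integrable (fun z => g j z ^ 2) (mixLaw (p j) τ) := fun j =>
    integrable_of_le_weight ((hgm j).pow_const 2) (hgb2 j) (hw j)
  have hLp : ∀ j, MemLp (fun ω => g j (observe τ (κ j ω) (X j ω) (ε j ω))) 2 P := fun j =>
    (memLp_two_iff_integrable_sq ((hgm j).comp (h.measurable_observe j)).aestronglyMeasurable).2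
      (h.integrable_observe hS hdet hv hp j (hint2 j))
  have hvar : ∀ j, variance (fun ω => g j (observe τ (κ j ω) (X j ω) (ε j ω))) P ≤
      K ^ 2 * weightMoment τ (N * 2) := by
    intro j
    refine (variance_le_expectation_sq (hLp j).aestronglyMeasurable).trans ?_
    have h1 := h.integral_observe hS hdet hv hp j ((hgm j).pow_const 2)
    calc _ = ∫ z, g j z ^ 2 ∂(mixLaw (p j) τ) := h1
      _ ≤ ∫ z, K ^ 2 * (1 + ‖z‖) ^ (N * 2) ∂(mixLaw (p j) τ) :=
          integral_mono (hint2 j) ((hw j).const_mul _) fun z => (le_abs_self _).trans (hgb2 j z)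
      _ ≤ _ := by
          rw [integral_const_mul]
          exact mul_le_mul_of_nonneg_left (integral_weight_mixLaw_le hS hdet hv (hp0 j)
            (h.mixing_prob_le_one j) _) (sq_nonneg K)
  have hind : Pairwise fun j k => IndepFun (fun ω => g j (observe τ (κ j ω) (X j ω) (ε j ω)))
      (fun ω => g k (observe τ (κ k ω) (X k ω) (ε k ω))) P := fun j k hjk =>
    (h.indepFun_observe.indepFun hjk).comp (hgm j) (hgm k)
  refine tendstoInMeasure_zero_of_abs_le (tendstoInMeasure_mean_sub_integral hind hLp hvar)
    fun n ω => le_of_eq ?_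
  rw [abs_of_nonneg (by positivity), fisher_apply, empInfo, Matrix.of_apply,
    ← Finset.sum_sub_distrib]
  congr 2
  refine Finset.sum_congr rfl fun j _ => ?_
  rw [h.integral_observe hS hdet hv hp j (hgm j)]
  rfl

/-- The empirical information at a consistent estimator is close to that at the true parameter. -/
theorem IsNormalModel.tendstoInMeasure_empInfo_sub [IsProbabilityMeasure P]
    (h : IsNormalModel P p τ κ X ε) (hS : ∀ m, (regCov τ m).PosSemidef)
    (hdet : ∀ m, (regCov τ m).det ≠ 0) (hv : ∀ m, 0 < errVar τ m) (hd : ∀ m, 0 < (regCov τ m).det)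
    (hp : ∀ j m, 0 < p j m) {τhat : ℕ → Ω → Param d M}
    (hτ : TendstoInMeasure P τhat atTop (fun _ => τ)) (i l : Fin M × Coord d) :
    TendstoInMeasure P (fun (n : ℕ) ω => (1 / (n : ℝ)) *
      |empInfo p (fun j => observe τ (κ j ω) (X j ω) (ε j ω)) n (τhat n ω) i l -
        empInfo p (fun j => observe τ (κ j ω) (X j ω) (ε j ω)) n τ i l|)
      atTop (fun _ => (0 : ℝ)) := by
  obtain ⟨N, -, hN⟩ := weightedContinuousAt_score_mul hv hd hp i l
  have hp0 : ∀ j m, 0 ≤ p j m := fun j m => (hp j m).le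
  set ξ : ℕ → Ω → Obs d := fun j ω => observe τ (κ j ω) (X j ω) (ε j ω) with hξ
  set S : ℕ → Ω → ℝ := fun n ω => (1 / (n : ℝ)) * ∑ j ∈ Finset.range n, (1 + ‖ξ j ω‖) ^ N with hSdef
  have hSnn : ∀ n ω, 0 ≤ S n ω := fun n ω => by positivity
  have hwint : ∀ j, Integrable (fun ω => (1 + ‖ξ j ω‖) ^ N) P := fun j =>
    h.integrable_observe hS hdet hv hp j (integrable_weight_mixLaw hS hdet hv (hp0 j) N)
  have hSint : ∀ n, Integrable (S n) P := fun n =>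
    (integrable_finsetSum _ fun j _ => hwint j).const_mul _
  have hSle : ∀ n, ∫ ω, S n ω ∂P ≤ weightMoment τ N := by
    intro n
    simp only [hSdef]
    rw [integral_const_mul, integral_finsetSum _ fun j _ => hwint j]
    have h1 : ∀ j, ∫ ω, (1 + ‖ξ j ω‖) ^ N ∂P ≤ weightMoment τ N := fun j =>
      (h.integral_observe hS hdet hv hp j (f := fun z => (1 + ‖z‖) ^ N) (by fun_prop)).trans_le
        (integral_weight_mixLaw_le hS hdet hv (hp0 j) (h.mixing_prob_le_one j) N)
    rcases Nat.eq_zero_or_pos n with rfl | hn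
    · simpa using weightMoment_nonneg τ N
    · have hn' : (0 : ℝ) < n := Nat.cast_pos.2 hn
      rw [one_div, inv_mul_le_iff₀ hn']
      exact (Finset.sum_le_sum fun j _ => h1 j).trans (by simp)
  rw [tendstoInMeasure_zero_iff]
  intro δ hδ
  have hmarkov : ∀ e > 0, ∀ n, P {ω | δ / e ≤ S n ω} ≤
      ENNReal.ofReal (weightMoment τ N / δ * e) := by
    intro e he n
    have h1 := (mul_meas_ge_le_integral_of_nonneg (ae_of_all _ (hSnn n)) (hSint n) (δ / e)).trans
      (hSle n)
    rw [← ofReal_measureReal]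
    refine ENNReal.ofReal_le_ofReal ?_
    rw [div_mul_eq_mul_div, le_div_iff₀ hδ]
    have h2 : P.real {ω | δ / e ≤ S n ω} * δ = e * (δ / e * P.real {ω | δ / e ≤ S n ω}) := by
      field_simp
    rw [h2, mul_comm _ e]
    exact mul_le_mul_of_nonneg_left h1 he.le
  rw [ENNReal.tendsto_nhds_zero]
  intro η hη
  have hη2 : 0 < η / 2 := ENNReal.half_pos hη.ne'
  -- The order of choice matters: `e` makes the Markov bound small for all `n` at once, then the
  -- radius `r` depends on `e`, and only then is `n` taken large.
  obtain ⟨e, he, hen⟩ : ∃ e > 0, ENNReal.ofReal (weightMoment τ N / δ * e) ≤ η / 2 := by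
    have h1 : Tendsto (fun e : ℝ => ENNReal.ofReal (weightMoment τ N / δ * e)) (𝓝[>] 0) (𝓝 0) := by
      have : Continuous fun e : ℝ => ENNReal.ofReal (weightMoment τ N / δ * e) :=
        ENNReal.continuous_ofReal.comp (by fun_prop)
      have h2 := this.tendsto 0
      simp only [mul_zero, ENNReal.ofReal_zero] at h2
      exact h2.mono_left nhdsWithin_le_nhds
    obtain ⟨e, h2, h3⟩ := ((ENNReal.tendsto_nhds_zero.1 h1 _ hη2).and self_mem_nhdsWithin).exists
    exact ⟨e, h3, h2⟩
  obtain ⟨r, hr, hball⟩ := Metric.eventually_nhds_iff.1 (hN e he)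
  have hfar := tendstoInMeasure_iff_dist.1 hτ r hr
  filter_upwards [ENNReal.tendsto_nhds_zero.1 hfar _ hη2] with n hn
  -- Outside the two exceptional sets the pointwise modulus of continuity applies at the random
  -- value of the estimator, and the change is at most `e * S n ω < δ`.
  have hsub : {ω | δ ≤ |((1 / (n : ℝ)) * |empInfo p (fun j => ξ j ω) n (τhat n ω) i l -
      empInfo p (fun j => ξ j ω) n τ i l|)|} ⊆
      {ω | r ≤ dist (τhat n ω) τ} ∪ {ω | δ / e ≤ S n ω} := by
    intro ω hω
    by_contra hcon
    simp only [Set.mem_union, Set.mem_ofPred_eq, not_or, not_le] at hcon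
    have hclose := hball hcon.1
    have h1 : |empInfo p (fun j => ξ j ω) n (τhat n ω) i l - empInfo p (fun j => ξ j ω) n τ i l| ≤
        e * ∑ j ∈ Finset.range n, (1 + ‖ξ j ω‖) ^ N := by
      simp only [empInfo, Matrix.of_apply]
      rw [← Finset.sum_sub_distrib, Finset.mul_sum]
      exact (Finset.abs_sum_le_sum_abs _ _).trans
        (Finset.sum_le_sum fun j _ => hclose (j, ξ j ω))
    have h2 : (1 / (n : ℝ)) * |empInfo p (fun j => ξ j ω) n (τhat n ω) i l -
        empInfo p (fun j => ξ j ω) n τ i l| ≤ e * S n ω := by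
      refine (mul_le_mul_of_nonneg_left h1 (by positivity)).trans (le_of_eq ?_)
      simp only [hSdef]
      ring
    have h3 : e * S n ω < δ := by
      rw [mul_comm]
      exact (lt_div_iff₀ he).1 hcon.2
    have h4 : δ ≤ |((1 / (n : ℝ)) * |empInfo p (fun j => ξ j ω) n (τhat n ω) i l -
      empInfo p (fun j => ξ j ω) n τ i l|)| := hω
    rw [abs_of_nonneg (by positivity)] at h4
    linarith
  calc _ ≤ P ({ω | r ≤ dist (τhat n ω) τ} ∪ {ω | δ / e ≤ S n ω}) := measure_mono hsub
    _ ≤ η / 2 + η / 2 := (measure_union_le _ _).trans (add_le_add hn ((hmarkov e he n).trans hen))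
    _ = η := ENNReal.add_halves η

theorem IsNormalModel.tendstoInMeasure_quadNorm [IsProbabilityMeasure P]
    (h : IsNormalModel P p τ κ X ε) (hS : ∀ m, (regCov τ m).PosSemidef)
    (hdet : ∀ m, (regCov τ m).det ≠ 0) (hv : ∀ m, 0 < errVar τ m) (hd : ∀ m, 0 < (regCov τ m).det)
    (hp : ∀ j m, 0 < p j m) {τhat : ℕ → Ω → Param d M}
    (hτ : TendstoInMeasure P τhat atTop (fun _ => τ)) :
    TendstoInMeasure P (fun (n : ℕ) ω => (1 / (n : ℝ)) * quadNorm (fisher p n τ -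
      empInfo p (fun j => observe τ (κ j ω) (X j ω) (ε j ω)) n (τhat n ω)))
      atTop (fun _ => (0 : ℝ)) := by
  refine tendstoInMeasure_zero_of_abs_le (tendstoInMeasure_zero_sum Finset.univ fun i _ =>
    tendstoInMeasure_zero_sum Finset.univ fun l _ => tendstoInMeasure_zero_add
      (h.tendstoInMeasure_fisher_sub hS hdet hv hd hp i l)
      (h.tendstoInMeasure_empInfo_sub hS hdet hv hd hp hτ i l)) fun n ω => ?_
  rw [abs_of_nonneg (mul_nonneg (by positivity) (quadNorm_nonneg _))]
  refine (mul_le_mul_of_nonneg_left (quadNorm_le_sum _) (by positivity)).trans ?_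
  simp_rw [Finset.mul_sum, ← mul_add]
  refine Finset.sum_le_sum fun i _ => Finset.sum_le_sum fun l _ =>
    mul_le_mul_of_nonneg_left ?_ (by positivity)
  rw [Matrix.sub_apply]
  refine (abs_sub_le _ (empInfo p (fun j => observe τ (κ j ω) (X j ω) (ε j ω)) n τ i l) _).trans ?_
  rw [abs_sub_comm (empInfo p (fun j => observe τ (κ j ω) (X j ω) (ε j ω)) n (τhat n ω) i l)]

end MixReg

end

theorem theorem3 {d M : ℕ} {Ω : Type*} [MeasurableSpace Ω] (P : Measure Ω)
    [IsProbabilityMeasure P]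
    -- mixing probabilities and true parameters
    (p : ℕ → Fin M → ℝ) (τ : Param d M)
    -- the sample
    (κ : ℕ → Ω → Fin M) (X : ℕ → Ω → EuclideanSpace ℝ (Fin d)) (ε : ℕ → Ω → ℝ)
    (hmodel : IsNormalModel P p τ κ X ε)
    (hcov : ∀ m, (regCov τ m).PosSemidef)
    -- nondegeneracy
    (hvar : ∀ m, 0 < errVar τ m)
    (hdet : ∀ m, (regCov τ m).det ≠ 0)
    -- the mixing probabilities are bounded away from zero
    (hp : ∃ c : ℝ, 0 < c ∧ ∀ j m, c < p j m)
    -- the components have different parameters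
    (hne : ∀ l m, l ≠ m → component τ l ≠ component τ m) :
    -- the expectations in the Fisher information are finite
    (∀ j i l, Integrable (fun z => score z (p j) τ i * score z (p j) τ l) (mixLaw (p j) τ)) ∧
    (∃ c₀ C₁ : ℝ, 0 < c₀ ∧ c₀ < C₁ ∧ ∀ n : ℕ, 1 ≤ n →
      c₀ * n ≤ quadNorm (fisher p n τ) ∧ quadNorm (fisher p n τ) ≤ C₁ * n) ∧
    (∀ τhat : ℕ → Ω → Param d M,
      TendstoInMeasure P τhat atTop (fun _ => τ) →
      TendstoInMeasure P
        (fun (n : ℕ) ω => (1 / (n : ℝ)) * quadNorm (fisher p n τ -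
          empInfo p (fun j => observe τ (κ j ω) (X j ω) (ε j ω)) n (τhat n ω)))
        atTop (fun _ => (0 : ℝ))) := by

  obtain ⟨c, hc, hpc⟩ := hp
  have hp0 : ∀ j m, 0 < p j m := fun j m => hc.trans (hpc j m)
  have hd : ∀ m, 0 < (regCov τ m).det := fun m =>
    lt_of_le_of_ne (hcov m).det_nonneg (Ne.symm (hdet m))
  -- A sample point exists, and the component of subject `0` there supplies an element of `Fin M`
  -- for the lower bound.
  obtain ⟨ω⟩ := P.nonempty_of_neZero
  refine ⟨fun j i l => integrable_mixLaw hcov hdet hvar (fun m => (hp0 j m).le)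
    (integrable_score_mul_compLaw hvar hd (hp0 j) i l), ?_, fun τhat hτ =>
    hmodel.tendstoInMeasure_quadNorm hcov hdet hvar hd hp0 hτ⟩
  exact exists_quadNorm_fisher_bounds hcov hdet hvar hd hc hpc hmodel.mixing_prob_le_one (κ 0 ω)
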